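/- Let $X,Y$ be complex Banach spaces with open unit balls $B_X,B_Y$. For a complex Banach space $E$, let $\mathcal HL_0(B_X,E)$ be the Banach space of all holomorphic (complex Fréchet differentiable) Lipschitz functions $f\colon B_X\to E$ with $f(0)=0$, normed by the Lipschitz constant $L(f)=\sup_{x\ne y}\|f(x)-f(y)\|/\|x-y\|$, and put $\mathcal HL_0(B_X)=\mathcal HL_0(B_X,\mathbb C)$, which is closed under pointwise products. For $x\in B_X$ let $\delta(x)\in\mathcal HL_0(B_X)^*$ be evaluation at $x$, and let $\mathcal G_0(B_X)=\overline{\operatorname{span}}\{\delta(x):x\in B_X\}\subseteq\mathcal HL_0(B_X)^*$ (norm closure). The dual of $\mathcal G_0(B_X)$ is identified with $\mathcal HL_0(B_X)$ through $\langle f,\mu\rangle=\mu(f)$. Let $\tau_0$ and $\tau_p$ denote the topologies on $\mathcal HL_0(B_X)$ (and, likewise, on $\mathcal HL_0(B_Y)$) of uniform convergence on compact subsets of the ball and of pointwise convergence on the ball, respectively. $X$ has the bounded approximation property (BAP) if there is $\lambda>0$ such that for every compact $K\subseteq X$ and every $\varepsilon>0$ there is a finite-rank bounded linear operator $S\colon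 X\to X$ with $\|S\|\le\lambda$ and $\|Sx-x\|<\varepsilon$ for all $x\in K$. Let $A\colon\mathcal HL_0(B_X)\to\mathcal HL_0(B_Y)$ be a linear map that is multiplicative, i.e. $A(f\cdot g)=A(f)\cdot A(g)$ for all $f,g$ (continuity of $A$ is not assumed), and consider the following statements. 1. $A$ is a composition operator: there is $\phi\in\mathcal HL_0(B_Y,X)$ with $\phi(B_Y)\subseteq B_X$ such that $A(f)=f\circ\phi$ for all $f\in\mathcal HL_0(B_X)$. 2. There is a continuous linear map $T\colon\mathcal G_0(B_Y)\to\mathcal G_0(B_X)$ such that $A=T^*$, i.e. $\mu(A(f))=(T\mu)(f)$ for all $f\in\mathcal HL_0(B_X)$ and $\mu\in\mathcal G_0(B_Y)$. 3. $A$ is $\tau_0$-$\tau_0$-continuous. 4. $A$ is $\tau_p$-$\tau_p$-continuous. Then (1) implies each of (2), (3) and (4), and each of (3) and (4) implies (2). If $X$ has the BAP, then the statements (1)–(4) are equivalent. -/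

import Mathlib

open scoped NNReal Topology

noncomputable section

section HolomorphicLipschitz

variable (X : Type*) [NormedAddCommGroup X] [NormedSpace ℂ X]
variable (E : Type*) [NormedAddCommGroup E] [NormedSpace ℂ E]

/-- The open unit ball `B_X` of `X`. -/
abbrev UnitBall : Set X := Metric.ball (0 : X) 1

/-- The origin, as a point of the open unit ball. -/
def UnitBall.origin : UnitBall X := ⟨0, Metric.mem_ball_self one_pos⟩

variable {X E}

/-- A function on the open unit ball is holomorphic if it is complex Fréchet differentiable at each
point of the ball. (The function is given on the ball only; `F` is any function on `X` restricting
to it, and differentiability on the open ball does not depend on the values of `F` elsewhere.) -/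
def IsHolomorphicOnBall (f : UnitBall X → E) : Prop :=
  ∃ F : X → E, DifferentiableOn ℂ F (UnitBall X) ∧ ∀ x : UnitBall X, F x = f x

variable (X E)

/-- The vector space of all holomorphic Lipschitz functions `f : B_X → E` with `f 0 = 0`. -/
def HL0.submodule : Submodule ℂ (UnitBall X → E) where
  carrier := {f | IsHolomorphicOnBall f ∧ (∃ C : ℝ≥0, LipschitzWith C f) ∧
    f (UnitBall.origin X) = 0}
  zero_mem' := ⟨⟨0, differentiableOn_const 0, fun _ => rfl⟩, ⟨0, LipschitzWith.const 0⟩, rfl⟩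
  add_mem' := by
    rintro f g ⟨⟨F, hF, hFf⟩, ⟨C, hC⟩, hf0⟩ ⟨⟨G, hG, hGg⟩, ⟨D, hD⟩, hg0⟩
    refine ⟨⟨F + G, hF.add hG, fun x => by simp [hFf, hGg]⟩, ⟨C + D, hC.add hD⟩, ?_⟩
    simp [hf0, hg0]
  smul_mem' := by
    rintro c f ⟨⟨F, hF, hFf⟩, ⟨C, hC⟩, hf0⟩
    refine ⟨⟨c • F, hF.const_smul c, fun x => by simp [hFf]⟩, ⟨‖c‖₊ * C, ?_⟩, ?_⟩
    · refine LipschitzWith.of_dist_le_mul fun x y => ?_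
      have := hC.dist_le_mul x y
      rw [Pi.smul_apply, Pi.smul_apply, dist_smul₀, NNReal.coe_mul, coe_nnnorm, mul_assoc]
      gcongr
    · simp [hf0]

/-- The space `𝓗L₀(B_X, E)`, a type of its own so that it carries the topology of the Lipschitz
norm rather than that of pointwise convergence. -/
def HL0 : Type _ := HL0.submodule X E

namespace HL0

instance : AddCommGroup (HL0 X E) := inferInstanceAs (AddCommGroup (HL0.submodule X E))

instance : Module ℂ (HL0 X E) := inferInstanceAs (Module ℂ (HL0.submodule X E))

instance : FunLike (HL0 X E) (UnitBall X) E where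
  coe f := f.1
  coe_injective := Subtype.val_injective

variable {X E}

@[simp] theorem add_apply (f g : HL0 X E) (x : UnitBall X) : (f + g) x = f x + g x := rfl

@[simp] theorem smul_apply (c : ℂ) (f : HL0 X E) (x : UnitBall X) : (c • f) x = c • f x := rfl

@[simp] theorem zero_apply (x : UnitBall X) : (0 : HL0 X E) x = 0 := rfl

@[simp] theorem apply_origin (f : HL0 X E) : f (UnitBall.origin X) = 0 := f.2.2.2

theorem isHolomorphic (f : HL0 X E) : IsHolomorphicOnBall (f : UnitBall X → E) := f.2.1

theorem exists_lipschitzWith (f : HL0 X E) : ∃ C : ℝ≥0, LipschitzWith C (f : UnitBall X → E) :=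
  f.2.2.1

/-- The Lipschitz constant `L(f) = sup_{x ≠ y} ‖f x - f y‖ / ‖x - y‖`, as the norm of `f`.
(Pairs with `x = y` contribute the harmless value `0 / 0 = 0`.) -/
instance : Norm (HL0 X E) where
  norm f := ⨆ p : UnitBall X × UnitBall X, ‖f p.1 - f p.2‖ / ‖(p.1 : X) - (p.2 : X)‖

theorem norm_def (f : HL0 X E) : ‖f‖ =
    ⨆ p : UnitBall X × UnitBall X, ‖f p.1 - f p.2‖ / ‖(p.1 : X) - (p.2 : X)‖ := rfl

instance : Nonempty (UnitBall X) := ⟨UnitBall.origin X⟩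

theorem bddAbove (f : HL0 X E) : BddAbove (Set.range fun p : UnitBall X × UnitBall X =>
    ‖f p.1 - f p.2‖ / ‖(p.1 : X) - (p.2 : X)‖) := by
  obtain ⟨C, hC⟩ := f.exists_lipschitzWith
  refine ⟨C, ?_⟩
  rintro _ ⟨p, rfl⟩
  refine div_le_of_le_mul₀ (norm_nonneg _) C.2 ?_
  have := hC.dist_le_mul p.1 p.2
  rwa [dist_eq_norm, Subtype.dist_eq, dist_eq_norm] at this

theorem lipschitz_bound (f : HL0 X E) (x y : UnitBall X) :
    ‖f x - f y‖ ≤ ‖f‖ * ‖(x : X) - (y : X)‖ := by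
  rcases eq_or_ne x y with rfl | h
  · simp
  · have hpos : 0 < ‖(x : X) - (y : X)‖ := norm_pos_iff.2 (sub_ne_zero.2 (Subtype.coe_ne_coe.2 h))
    rw [← div_le_iff₀ hpos]
    exact le_ciSup f.bddAbove (x, y)

theorem norm_apply_le (f : HL0 X E) (x : UnitBall X) : ‖f x‖ ≤ ‖f‖ * ‖(x : X)‖ := by
  have h := f.lipschitz_bound x (UnitBall.origin X)
  rwa [apply_origin, sub_zero, UnitBall.origin, sub_zero] at h

theorem normedSpaceCore : NormedSpace.Core ℂ (HL0 X E) where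
  norm_nonneg f := Real.iSup_nonneg fun _ => by positivity
  norm_smul c f := by
    rw [norm_def, norm_def, Real.mul_iSup_of_nonneg (norm_nonneg c)]
    congr 1
    ext p
    rw [smul_apply, smul_apply, ← smul_sub, norm_smul, mul_div_assoc]
  norm_triangle f g := by
    rw [norm_def (f + g)]
    refine ciSup_le fun p => ?_
    have hf := le_ciSup f.bddAbove p
    have hg := le_ciSup g.bddAbove p
    refine le_trans ?_ (add_le_add hf hg)
    rw [← add_div]
    gcongr
    rw [add_apply, add_apply, add_sub_add_comm]
    exact norm_add_le _ _
  norm_eq_zero_iff f := by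
    constructor
    · intro h
      refine DFunLike.ext _ _ fun x => ?_
      have := f.norm_apply_le x
      rw [h, zero_mul] at this
      simpa using this
    · rintro rfl
      simp [norm_def]

instance : NormedAddCommGroup (HL0 X E) := NormedAddCommGroup.ofCore normedSpaceCore

instance : NormedSpace ℂ (HL0 X E) := NormedSpace.ofCore normedSpaceCore

/-- The pointwise product on `𝓗L₀(B_X)`. -/
instance : Mul (HL0 X ℂ) where
  mul f g := ⟨fun x => f x * g x, by
    obtain ⟨F, hF, hFf⟩ := f.isHolomorphic
    obtain ⟨G, hG, hGg⟩ := g.isHolomorphic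
    refine ⟨⟨F * G, hF.mul hG, fun x => by simp [hFf, hGg]⟩,
      ⟨‖f‖₊ * ‖g‖₊ + ‖f‖₊ * ‖g‖₊, ?_⟩, by simp⟩
    refine LipschitzWith.of_dist_le_mul fun x y => ?_
    rw [dist_eq_norm, Subtype.dist_eq, dist_eq_norm]
    have hx : ‖(x : X)‖ ≤ 1 := (mem_ball_zero_iff.1 x.2).le
    have hy : ‖(y : X)‖ ≤ 1 := (mem_ball_zero_iff.1 y.2).le
    have e : f x * g x - f y * g y = f x * (g x - g y) + (f x - f y) * g y := by ring
    have h1 : ‖f x‖ ≤ ‖f‖ :=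
      (f.norm_apply_le x).trans (mul_le_of_le_one_right (norm_nonneg _) hx)
    have h2 : ‖g y‖ ≤ ‖g‖ :=
      (g.norm_apply_le y).trans (mul_le_of_le_one_right (norm_nonneg _) hy)
    rw [e]
    calc _ ≤ ‖f x‖ * ‖g x - g y‖ + ‖f x - f y‖ * ‖g y‖ := by
            refine (norm_add_le _ _).trans ?_
            rw [norm_mul, norm_mul]
      _ ≤ ‖f‖ * (‖g‖ * ‖(x : X) - (y : X)‖) + (‖f‖ * ‖(x : X) - (y : X)‖) * ‖g‖ := by
            gcongr
            · exact g.lipschitz_bound x y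
            · exact f.lipschitz_bound x y
      _ = _ := by push_cast; ring⟩

@[simp] theorem mul_apply (f g : HL0 X ℂ) (x : UnitBall X) : (f * g) x = f x * g x := rfl

/-- The evaluation functional `δ(x)` in the dual of `𝓗L₀(B_X)`. -/
def delta (x : UnitBall X) : StrongDual ℂ (HL0 X ℂ) :=
  LinearMap.mkContinuous
    { toFun := fun f => f x, map_add' := fun _ _ => rfl, map_smul' := fun _ _ => rfl } ‖(x : X)‖
    fun f => (f.norm_apply_le x).trans_eq (mul_comm _ _)

@[simp] theorem delta_apply (x : UnitBall X) (f : HL0 X ℂ) : delta x f = f x := rfl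

variable (X)

/-- The topology `τ₀` on `𝓗L₀(B_X)` of uniform convergence on the compact subsets of `B_X`. -/
@[reducible] def tau0 : TopologicalSpace (HL0 X ℂ) :=
  TopologicalSpace.induced
    (fun f : HL0 X ℂ => UniformOnFun.ofFun {K : Set (UnitBall X) | IsCompact K} (f : UnitBall X → ℂ))
    inferInstance

/-- The topology `τ_p` on `𝓗L₀(B_X)` of pointwise convergence on `B_X`. -/
@[reducible] def tauP : TopologicalSpace (HL0 X ℂ) :=
  TopologicalSpace.induced (fun f : HL0 X ℂ => (f : UnitBall X → ℂ)) Pi.topologicalSpace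

end HL0

/-- The holomorphic Lipschitz-free space `𝓖₀(B_X)`: the norm-closed linear span of the evaluation
functionals in the dual of `𝓗L₀(B_X)`. -/
def G0 : Submodule ℂ (StrongDual ℂ (HL0 X ℂ)) :=
  (Submodule.span ℂ (Set.range (HL0.delta (X := X)))).topologicalClosure

/-- The bounded approximation property: for some `lam > 0`, the identity of `X` is approximated,
uniformly on compact sets, by finite-rank operators of norm at most `lam`. -/
def HasBAP : Prop :=
  ∃ lam : ℝ, 0 < lam ∧ ∀ K : Set X, IsCompact K → ∀ ε : ℝ, 0 < ε →
    ∃ T : X →L[ℂ] X, FiniteDimensional ℂ (LinearMap.range (T : X →ₗ[ℂ] X)) ∧ ‖T‖ ≤ lam ∧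
      ∀ x ∈ K, ‖T x - x‖ < ε

variable {X}
variable {Y : Type*} [NormedAddCommGroup Y] [NormedSpace ℂ Y]

/-- `A` is a composition operator: `A f = f ∘ φ` for some `φ ∈ 𝓗L₀(B_Y, X)` mapping `B_Y` into
`B_X`. -/
def IsCompositionOperator (A : HL0 X ℂ → HL0 Y ℂ) : Prop :=
  ∃ (φ : HL0 Y X) (hφ : ∀ y : UnitBall Y, φ y ∈ UnitBall X),
    ∀ (f : HL0 X ℂ) (y : UnitBall Y), A f y = f ⟨φ y, hφ y⟩

/-- `A = T^*`, where `f ∈ 𝓗L₀(B_X)` acts on `𝓖₀(B_X)` as `μ ↦ μ f` (this identifies `𝓗L₀(B_X)`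
with the dual of `𝓖₀(B_X)`): `⟨A f, μ⟩ = ⟨f, T μ⟩` for all `f` and `μ`. -/
def IsAdjointOf (A : HL0 X ℂ → HL0 Y ℂ) (T : G0 Y →L[ℂ] G0 X) : Prop :=
  ∀ (f : HL0 X ℂ) (μ : G0 Y),
    (μ : StrongDual ℂ (HL0 Y ℂ)) (A f) = (T μ : StrongDual ℂ (HL0 X ℂ)) f

end HolomorphicLipschitz

end

/-! Everything reduces to the functionals `f ↦ A f y`. If they are `τ₀`-continuous, which (3) and
(4) both ensure since `τ_p` is coarser than `τ₀`, each of them lies in `𝓖₀(B_X)`: it is controlled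
on a compact set, so up to a small norm error it is a combination of evaluations on a finite net
(`G0.exists_mem_of_continuous_tau0`). The closed graph theorem makes `A` bounded, and its adjoint
then restricts to the required `T`. Composition operators are continuous for both topologies.

The BAP enters only in (2) ⇒ (1). Each `T (δ y)` is a multiplicative `u ∈ 𝓖₀(B_X)`, and on `X^*` it
acts as evaluation at a point `φ y` of `X` (`G0.exists_barycenter`). The map `φ` inherits holomorphy
and the Lipschitz property from `δ`. A spectral argument (`norm_apply_ofDual_le_one`) and the
Schwarz lemma give `‖φ y‖ ≤ ‖y‖`. It remains to see that `u f = f (φ y)` for every `f`.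
Multiplicativity determines `u` on the Cauchy kernels `(ζ - s)⁻¹` with `s ∈ X^*`; iterated Cauchy
integrals then give `u` on `f` composed with small finite-rank operators
(`ReproducesAt.comp_add_sum_smul`). The identity theorem in a dilation parameter removes the
smallness, and the BAP with bounded pointwise limits passes from finite rank to the identity
(`G0.apply_eq_of_hasBAP`). -/

section

open Filter Metric

/-! ### Basic estimates and completeness of `𝓗L₀`. -/

namespace HL0

variable {X : Type*} [NormedAddCommGroup X] [NormedSpace ℂ X]
variable {E : Type*} [NormedAddCommGroup E] [NormedSpace ℂ E]

/-- The extension by zero of an element of `𝓗L₀(B_X, E)` to the whole space. -/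
noncomputable def extend (f : HL0 X E) : X → E := Function.extend Subtype.val f 0

@[simp] theorem extend_apply (f : HL0 X E) (x : UnitBall X) : f.extend x = f x :=
  Subtype.val_injective.extend_apply _ _ _

theorem extend_of_mem (f : HL0 X E) {x : X} (hx : x ∈ UnitBall X) : f.extend x = f ⟨x, hx⟩ :=
  f.extend_apply ⟨x, hx⟩

@[simp] theorem extend_zero (f : HL0 X E) : f.extend 0 = 0 :=
  (f.extend_apply (UnitBall.origin X)).trans f.apply_origin

theorem differentiableOn_extend (f : HL0 X E) : DifferentiableOn ℂ f.extend (UnitBall X) := by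
  obtain ⟨F, hF, hFf⟩ := f.isHolomorphic
  exact hF.congr fun x hx => by rw [f.extend_of_mem hx, ← hFf]

theorem norm_extend_sub_le (f : HL0 X E) {x y : X} (hx : x ∈ UnitBall X) (hy : y ∈ UnitBall X) :
    ‖f.extend x - f.extend y‖ ≤ ‖f‖ * ‖x - y‖ := by
  rw [f.extend_of_mem hx, f.extend_of_mem hy]
  exact f.lipschitz_bound _ _

theorem norm_extend_le (f : HL0 X E) {x : X} (hx : x ∈ UnitBall X) : ‖f.extend x‖ ≤ ‖f‖ := by
  rw [f.extend_of_mem hx]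
  exact (f.norm_apply_le _).trans
    (mul_le_of_le_one_right (norm_nonneg _) (mem_ball_zero_iff.1 hx).le)

theorem norm_apply_le_norm (f : HL0 X E) (x : UnitBall X) : ‖f x‖ ≤ ‖f‖ := by
  simpa using f.norm_extend_le x.2

theorem continuous_coe (f : HL0 X E) : Continuous (f : UnitBall X → E) := by
  obtain ⟨C, hC⟩ := f.exists_lipschitzWith
  exact hC.continuous

@[simp] theorem sub_apply (f g : HL0 X E) (x : UnitBall X) : (f - g) x = f x - g x := rfl

theorem norm_le_of_lipschitz (f : HL0 X E) {C : ℝ} (hC : 0 ≤ C)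
    (h : ∀ x y : UnitBall X, ‖f x - f y‖ ≤ C * ‖(x : X) - (y : X)‖) : ‖f‖ ≤ C := by
  rw [norm_def]
  exact ciSup_le fun p => div_le_of_le_mul₀ (norm_nonneg _) hC (h p.1 p.2)

/-- The element `F - F 0` of `𝓗L₀(B_X, E)` attached to a function `F` which is holomorphic and
Lipschitz on the ball. -/
def ofBall (F : X → E) (hF : DifferentiableOn ℂ F (UnitBall X)) (C : ℝ)
    (hC : ∀ x ∈ UnitBall X, ∀ y ∈ UnitBall X, ‖F x - F y‖ ≤ C * ‖x - y‖) : HL0 X E :=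
  ⟨fun x => F x - F 0, ⟨fun x => F x - F 0, hF.sub_const _, fun _ => rfl⟩,
    ⟨C.toNNReal, LipschitzWith.of_dist_le_mul fun x y => by
      rw [dist_eq_norm, sub_sub_sub_cancel_right, Subtype.dist_eq, dist_eq_norm]
      refine (hC x x.2 y y.2).trans ?_
      gcongr
      exact Real.le_coe_toNNReal C⟩, by simp [UnitBall.origin]⟩

@[simp] theorem ofBall_apply (F : X → E) (hF : DifferentiableOn ℂ F (UnitBall X)) (C : ℝ)
    (hC : ∀ x ∈ UnitBall X, ∀ y ∈ UnitBall X, ‖F x - F y‖ ≤ C * ‖x - y‖) (x : UnitBall X) :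
    ofBall F hF C hC x = F x - F 0 := rfl

theorem norm_ofBall_le (F : X → E) (hF : DifferentiableOn ℂ F (UnitBall X)) {C : ℝ} (h0 : 0 ≤ C)
    (hC : ∀ x ∈ UnitBall X, ∀ y ∈ UnitBall X, ‖F x - F y‖ ≤ C * ‖x - y‖) :
    ‖ofBall F hF C hC‖ ≤ C :=
  norm_le_of_lipschitz _ h0 fun x y => by simpa using hC x x.2 y y.2

theorem norm_fderiv_extend_le (f : HL0 X E) {x : X} (hx : x ∈ UnitBall X) :
    ‖fderiv ℂ f.extend x‖ ≤ ‖f‖ := by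
  refine norm_fderiv_le_of_lip' ℂ (norm_nonneg f) ?_
  filter_upwards [isOpen_ball.mem_nhds hx] with y hy using f.norm_extend_sub_le hy hx

theorem hasFDerivAt_extend (f : HL0 X E) {x : X} (hx : x ∈ UnitBall X) :
    HasFDerivAt f.extend (fderiv ℂ f.extend x) x :=
  (f.differentiableOn_extend.differentiableAt (isOpen_ball.mem_nhds hx)).hasFDerivAt

theorem fderiv_extend_sub (f g : HL0 X E) {x : X} (hx : x ∈ UnitBall X) :
    fderiv ℂ (f - g).extend x = fderiv ℂ f.extend x - fderiv ℂ g.extend x := by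
  refine (((f.hasFDerivAt_extend hx).sub (g.hasFDerivAt_extend hx)).congr_of_eventuallyEq ?_).fderiv
  filter_upwards [isOpen_ball.mem_nhds hx] with y hy
  simp [extend_of_mem _ hy]

theorem cauchySeq_apply {u : ℕ → HL0 X E} (hu : CauchySeq u) (x : UnitBall X) :
    CauchySeq fun n => u n x := by
  rw [Metric.cauchySeq_iff'] at hu ⊢
  intro ε hε
  obtain ⟨N, hN⟩ := hu ε hε
  refine ⟨N, fun n hn => lt_of_le_of_lt ?_ (hN n hn)⟩
  rw [dist_eq_norm, dist_eq_norm, ← sub_apply]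
  exact norm_apply_le_norm _ _

/-- Needed for the closed graph theorem. The Lipschitz norm dominates the derivative uniformly on
the ball, so derivatives of a Cauchy sequence converge uniformly and the pointwise limit is again
holomorphic. -/
instance [CompleteSpace E] : CompleteSpace (HL0 X E) := by
  refine Metric.complete_of_cauchySeq_tendsto fun u hu => ?_
  choose g hg using fun x : UnitBall X => cauchySeq_tendsto_of_complete (cauchySeq_apply hu x)
  have hcauchy : UniformCauchySeqOn (fun n x => fderiv ℂ (u n).extend x) atTop (UnitBall X) := by
    rw [Metric.uniformCauchySeqOn_iff]
    intro ε hε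
    obtain ⟨N, hN⟩ := Metric.cauchySeq_iff.1 hu ε hε
    refine ⟨N, fun m hm n hn x hx => lt_of_le_of_lt ?_ (hN m hm n hn)⟩
    rw [dist_eq_norm, dist_eq_norm, ← fderiv_extend_sub _ _ hx]
    exact norm_fderiv_extend_le _ hx
  choose! g' hg' using fun x (hx : x ∈ UnitBall X) =>
    cauchySeq_tendsto_of_complete (hcauchy.cauchySeq hx)
  have hunif := hcauchy.tendstoUniformlyOn_of_tendsto hg'
  have hdiff : IsHolomorphicOnBall g := by
    refine ⟨Function.extend Subtype.val g 0, fun x hx => ?_,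
      fun x => Subtype.val_injective.extend_apply _ _ _⟩
    refine (hasFDerivAt_of_tendstoUniformlyOn isOpen_ball hunif
      (fun n x hx => (u n).hasFDerivAt_extend hx) (fun y hy => ?_)
      hx).differentiableAt.differentiableWithinAt
    lift y to UnitBall X using hy
    simpa [Subtype.val_injective.extend_apply] using hg y
  obtain ⟨C, hC⟩ := hu.norm_bddAbove
  replace hC : ∀ n, ‖u n‖ ≤ C := fun n => hC ⟨n, rfl⟩
  have hlip : ∀ x y : UnitBall X, ‖g x - g y‖ ≤ C * ‖(x : X) - (y : X)‖ := fun x y =>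
    le_of_tendsto ((hg x).sub (hg y)).norm (.of_forall fun n =>
      ((u n).lipschitz_bound x y).trans (by gcongr; exact hC n))
  have hg0 : g (UnitBall.origin X) = 0 :=
    tendsto_nhds_unique (hg _) (by simp)
  let G : HL0 X E := ⟨g, hdiff, ⟨C.toNNReal, LipschitzWith.of_dist_le_mul fun x y => by
      rw [dist_eq_norm, Subtype.dist_eq, dist_eq_norm]
      refine (hlip x y).trans ?_
      gcongr
      exact Real.le_coe_toNNReal C⟩, hg0⟩
  refine ⟨G, Metric.tendsto_atTop.2 fun ε hε => ?_⟩
  obtain ⟨N, hN⟩ := Metric.cauchySeq_iff.1 hu (ε / 2) (half_pos hε)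
  refine ⟨N, fun n hn => lt_of_le_of_lt ?_ (half_lt_self hε)⟩
  rw [dist_eq_norm]
  refine norm_le_of_lipschitz _ (half_pos hε).le fun x y => ?_
  refine le_of_tendsto ((tendsto_const_nhds.sub (hg x)).sub (tendsto_const_nhds.sub (hg y))).norm
    (f := fun m => _) (x := atTop) ?_
  filter_upwards [eventually_ge_atTop N] with m hm
  refine ((u n - u m).lipschitz_bound x y).trans ?_
  gcongr
  exact (dist_eq_norm (u n) (u m) ▸ hN n hn m hm).le

end HL0

/-! ### Limits, holomorphy and integrals under functionals in `𝓖₀(B_X)`. -/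

namespace G0

open HL0 (delta)

variable {X : Type*} [NormedAddCommGroup X] [NormedSpace ℂ X]

theorem delta_mem (x : UnitBall X) : delta x ∈ G0 X :=
  Submodule.le_topologicalClosure _ (Submodule.subset_span ⟨x, rfl⟩)

theorem exists_seq_tendsto {u : StrongDual ℂ (HL0 X ℂ)} (hu : u ∈ G0 X) :
    ∃ v : ℕ → StrongDual ℂ (HL0 X ℂ),
      (∀ n, v n ∈ Submodule.span ℂ (Set.range (delta (X := X)))) ∧ Tendsto v atTop (𝓝 u) := by
  rw [G0, ← SetLike.mem_coe, Submodule.topologicalClosure_coe] at hu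
  exact mem_closure_iff_seq_limit.1 hu

variable {P : Type*}

theorem tendstoUniformlyOn_apply {ι : Type*} {l : Filter ι} {v : ι → StrongDual ℂ (HL0 X ℂ)}
    {u : StrongDual ℂ (HL0 X ℂ)} (hv : Tendsto v l (𝓝 u)) {H : P → HL0 X ℂ} {C : ℝ} {s : Set P}
    (hC : ∀ p ∈ s, ‖H p‖ ≤ C) :
    TendstoUniformlyOn (fun n p => v n (H p)) (fun p => u (H p)) l s := by
  rw [Metric.tendstoUniformlyOn_iff]
  intro ε hε
  -- `C` may be zero, or negative when `s` is empty.
  have hC' : 0 < |C| + 1 := by positivity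
  filter_upwards [Metric.tendsto_nhds.1 hv (ε / (|C| + 1)) (by positivity)] with n hn p hp
  rw [dist_comm, dist_eq_norm, ← _root_.sub_apply]
  rw [dist_eq_norm, lt_div_iff₀ hC'] at hn
  refine lt_of_le_of_lt ((v n - u).le_opNorm _) (lt_of_le_of_lt ?_ hn)
  gcongr
  exact (hC p hp).trans ((le_abs_self C).trans (by linarith))

/-- Functionals in `𝓖₀(B_X)` commute with bounded pointwise limits. -/
theorem tendsto_apply {u : StrongDual ℂ (HL0 X ℂ)} (hu : u ∈ G0 X) {l : Filter P}
    {H : P → HL0 X ℂ} {h : HL0 X ℂ} {C : ℝ} (hC : ∀ᶠ p in l, ‖H p‖ ≤ C)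
    (hH : ∀ z, Tendsto (fun p => H p z) l (𝓝 (h z))) :
    Tendsto (fun p => u (H p)) l (𝓝 (u h)) := by
  obtain ⟨v, hv, hvu⟩ := exists_seq_tendsto hu
  have hspan : ∀ w ∈ Submodule.span ℂ (Set.range (delta (X := X))),
      Tendsto (fun p => w (H p)) l (𝓝 (w h)) := by
    intro w hw
    induction hw using Submodule.span_induction with
    | mem w hw => obtain ⟨z, rfl⟩ := hw; exact hH z
    | zero => simpa using tendsto_const_nhds
    | add w₁ w₂ _ _ h₁ h₂ => simpa using h₁.add h₂
    | smul c w _ h => simpa using h.const_mul c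
  -- Approximants from the span converge uniformly in `p` where `‖H p‖ ≤ C`, so the limits in `n`
  -- and `p` can be interchanged.
  have hunif : TendstoUniformlyOnFilter (fun n p => v n (H p)) (fun p => u (H p)) atTop l := by
    have := tendstoUniformlyOn_apply hvu (s := {p | ‖H p‖ ≤ C}) (H := H) fun p hp => hp
    exact (tendstoUniformlyOn_iff_tendstoUniformlyOnFilter.1 this).mono_right
      (le_principal_iff.2 hC)
  exact hunif.tendsto_of_eventually_tendsto (.of_forall fun n => hspan _ (hv n))
    (((ContinuousLinearMap.apply ℂ ℂ h).continuous.tendsto u).comp hvu)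

theorem continuousOn_apply {u : StrongDual ℂ (HL0 X ℂ)} (hu : u ∈ G0 X) [TopologicalSpace P]
    {H : P → HL0 X ℂ} {C : ℝ} {s : Set P} (hC : ∀ p ∈ s, ‖H p‖ ≤ C)
    (hH : ∀ z, ContinuousOn (fun p => H p z) s) : ContinuousOn (fun p => u (H p)) s :=
  fun p hp => tendsto_apply hu (eventually_nhdsWithin_of_forall hC) fun z => hH z p hp

/-- Weierstrass' theorem: `p ↦ u (H p)` is a uniform limit of the holomorphic functions given by
elements of the span. -/
theorem differentiableOn_apply {u : StrongDual ℂ (HL0 X ℂ)} (hu : u ∈ G0 X)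
    {H : ℂ → HL0 X ℂ} {C : ℝ} {s : Set ℂ} (hs : IsOpen s) (hC : ∀ p ∈ s, ‖H p‖ ≤ C)
    (hH : ∀ z, DifferentiableOn ℂ (fun p => H p z) s) :
    DifferentiableOn ℂ (fun p => u (H p)) s := by
  obtain ⟨v, hv, hvu⟩ := exists_seq_tendsto hu
  have hspan : ∀ w ∈ Submodule.span ℂ (Set.range (delta (X := X))),
      DifferentiableOn ℂ (fun p => w (H p)) s := by
    intro w hw
    induction hw using Submodule.span_induction with
    | mem w hw => obtain ⟨z, rfl⟩ := hw; exact hH z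
    | zero => simp
    | add w₁ w₂ _ _ h₁ h₂ => exact h₁.add h₂
    | smul c w _ h => exact h.const_mul c
  exact (tendstoUniformlyOn_apply hvu hC).tendstoLocallyUniformlyOn.differentiableOn
    (.of_forall fun n => hspan _ (hv n)) hs

/-- Functionals in `𝓖₀(B_X)` commute with pointwise circle integrals of bounded families. -/
theorem apply_eq_circleIntegral {u : StrongDual ℂ (HL0 X ℂ)} (hu : u ∈ G0 X)
    {H : ℂ → HL0 X ℂ} {h : HL0 X ℂ} {C R : ℝ} (hR : 0 ≤ R)
    (hC : ∀ ζ ∈ sphere (0 : ℂ) R, ‖H ζ‖ ≤ C)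
    (hH : ∀ z, ContinuousOn (fun ζ => H ζ z) (sphere 0 R))
    (hh : ∀ z, h z = ∮ ζ in C(0, R), H ζ z) :
    u h = ∮ ζ in C(0, R), u (H ζ) := by
  obtain ⟨v, hv, hvu⟩ := exists_seq_tendsto hu
  have hint : ∀ w ∈ G0 X, CircleIntegrable (fun ζ => w (H ζ)) 0 R := fun w hw =>
    (continuousOn_apply hw hC hH).circleIntegrable hR
  have hspan : ∀ w ∈ Submodule.span ℂ (Set.range (delta (X := X))),
      w h = ∮ ζ in C(0, R), w (H ζ) := by
    intro w hw
    induction hw using Submodule.span_induction with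
    | mem w hw => obtain ⟨z, rfl⟩ := hw; exact hh z
    | zero => simp [circleIntegral]
    | add w₁ w₂ m₁ m₂ h₁ h₂ =>
      simp only [_root_.add_apply, h₁, h₂]
      rw [circleIntegral.integral_add (hint _ (Submodule.le_topologicalClosure _ m₁))
        (hint _ (Submodule.le_topologicalClosure _ m₂))]
    | smul c w _ h => simp only [_root_.smul_apply, smul_eq_mul, h, circleIntegral.integral_const_mul]
  have hlim : Tendsto (fun n => v n h) atTop (𝓝 (u h)) :=
    ((ContinuousLinearMap.apply ℂ ℂ h).continuous.tendsto u).comp hvu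
  refine tendsto_nhds_unique hlim ?_
  rw [tendsto_iff_norm_sub_tendsto_zero]
  refine squeeze_zero (fun _ => norm_nonneg _) (g := fun n => 2 * Real.pi * R * (‖v n - u‖ * |C|))
    (fun n => ?_) ?_
  · rw [hspan _ (hv n), ← circleIntegral.integral_sub
      (hint _ (Submodule.le_topologicalClosure _ (hv n))) (hint _ hu)]
    refine circleIntegral.norm_integral_le_of_norm_le_const hR fun ζ hζ => ?_
    rw [← _root_.sub_apply]
    refine ((v n - u).le_opNorm _).trans ?_
    gcongr
    exact (hC ζ hζ).trans (le_abs_self C)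
  · have := ((tendsto_iff_norm_sub_tendsto_zero.1 hvu).mul_const |C|).const_mul (2 * Real.pi * R)
    simpa using this

end G0

/-! ### The topologies `τ₀` and `τ_p`, and the passage from continuity to adjoints. -/

section

variable {X : Type*} [NormedAddCommGroup X] [NormedSpace ℂ X]
variable {Y : Type*} [NormedAddCommGroup Y] [NormedSpace ℂ Y]

namespace HL0

theorem continuous_eval_tau0 (x : UnitBall X) :
    Continuous[tau0 X, inferInstance] fun f : HL0 X ℂ => f x := by
  let _ := tau0 X
  exact (UniformOnFun.uniformContinuous_eval_of_mem ℂ {K : Set (UnitBall X) | IsCompact K}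
    (Set.mem_singleton x) isCompact_singleton).continuous.comp continuous_induced_dom

theorem continuous_eval_tauP (x : UnitBall X) :
    Continuous[tauP X, inferInstance] fun f : HL0 X ℂ => f x := by
  let _ := tauP X
  exact (continuous_apply x).comp continuous_induced_dom

theorem tau0_le_tauP : tau0 X ≤ tauP X := by
  rw [tauP, ← continuous_iff_le_induced]
  let _ := tau0 X
  exact continuous_pi continuous_eval_tau0

/-- The free bound `M > 0` stands in for the supremum of `‖f‖` over `K`, which may vanish and could
not be used for rescaling. -/
theorem exists_isCompact_norm_le (l : HL0 X ℂ →ₗ[ℂ] ℂ) (hl : Continuous[tau0 X, inferInstance] l) :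
    ∃ K : Set (UnitBall X), IsCompact K ∧ ∃ C : ℝ, 0 ≤ C ∧ ∀ (f : HL0 X ℂ) (M : ℝ), 0 < M →
      (∀ x ∈ K, ‖f x‖ ≤ M) → ‖l f‖ ≤ C * M := by
  have h0 : l ⁻¹' ball 0 1 ∈ @nhds _ (tau0 X) 0 := by
    let _ := tau0 X
    exact hl.continuousAt (by simpa using ball_mem_nhds (0 : ℂ) one_pos)
  rw [nhds_induced, Filter.mem_comap] at h0
  obtain ⟨t, ht, htl⟩ := h0
  obtain ⟨⟨K, V⟩, ⟨hK, hV⟩, hKV⟩ := (UniformOnFun.hasBasis_nhds (UnitBall X) ℂ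
    {K : Set (UnitBall X) | IsCompact K} _ ⟨∅, isCompact_empty⟩
    (directedOn_of_sup_mem fun _ _ h₁ h₂ => IsCompact.union h₁ h₂)).mem_iff.1 ht
  obtain ⟨ε, hε, hεV⟩ := Metric.mem_uniformity_dist.1 hV
  have key : ∀ f : HL0 X ℂ, (∀ x ∈ K, ‖f x‖ < ε) → ‖l f‖ < 1 := by
    intro f hf
    have : f ∈ l ⁻¹' ball 0 1 := by
      refine htl (hKV fun x hx => hεV ?_)
      simpa using hf x hx
    simpa using this
  -- `key` needs a strict bound on `K`, so `f` is scaled to size at most `ε / 2` there; this costs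
  -- the factor 2.
  refine ⟨K, hK, 2 / ε, by positivity, fun f M hM hf => ?_⟩
  have hc : 0 < ε / (2 * M) := by positivity
  have := key (((ε / (2 * M) : ℝ) : ℂ) • f) fun x hx => by
    rw [smul_apply, norm_smul, Complex.norm_real, Real.norm_of_nonneg hc.le]
    calc ε / (2 * M) * ‖f x‖ ≤ ε / (2 * M) * M := by gcongr; exact hf x hx
      _ = ε / 2 := by field_simp
      _ < ε := half_lt_self hε
  rw [map_smul, norm_smul, Complex.norm_real, Real.norm_of_nonneg hc.le, div_mul_eq_mul_div,
    div_lt_one (by positivity)] at this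
  rw [div_mul_eq_mul_div, le_div_iff₀ hε]
  linarith

end HL0

namespace G0

open HL0 (delta tau0 tauP)

/-- A linear functional on `𝓗L₀(B_X)` which is continuous for the compact-open topology is given
by an element of `𝓖₀(B_X)`. -/
theorem exists_mem_of_continuous_tau0 (l : HL0 X ℂ →ₗ[ℂ] ℂ)
    (hl : Continuous[tau0 X, inferInstance] l) :
    ∃ u ∈ G0 X, ∀ f, u f = l f := by
  obtain ⟨K, hK, C, hC, hbound⟩ := HL0.exists_isCompact_norm_le l hl
  have hle : ∀ f, ‖l f‖ ≤ C * ‖f‖ := by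
    intro f
    rcases eq_or_ne f 0 with rfl | hf
    · simp
    · exact hbound f _ (norm_pos_iff.2 hf) fun x _ => f.norm_apply_le_norm x
  let u : StrongDual ℂ (HL0 X ℂ) := l.mkContinuous C hle
  refine ⟨u, ?_, fun f => rfl⟩
  rw [G0, ← SetLike.mem_coe, Submodule.topologicalClosure_coe, Metric.mem_closure_iff]
  intro ε hε
  obtain ⟨η, hη, hηε⟩ : ∃ η : ℝ, 0 < η ∧ C * η < ε :=
    ⟨ε / (C + 1), by positivity, by
      rw [mul_div_assoc', div_lt_iff₀ (by positivity)]; nlinarith⟩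
  -- A Lipschitz function vanishing on a finite `η`-net of `K` is at most `η * ‖f‖` on `K`, so `u`
  -- has norm at most `C * η` on the subspace `N` of such functions.
  obtain ⟨F, hFK, hF, hcover⟩ := hK.finite_cover_balls hη
  have := hF.fintype
  let N : Submodule ℂ (HL0 X ℂ) := ⨅ x : F, LinearMap.ker (delta (x : UnitBall X) : HL0 X ℂ →ₗ[ℂ] ℂ)
  have hN : ∀ f ∈ N, ∀ x ∈ F, f x = 0 := fun f hf x hx => (Submodule.mem_iInf _).1 hf ⟨x, hx⟩
  have hsmall : ∀ f ∈ N, ‖u f‖ ≤ C * η * ‖f‖ := by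
    intro f hf
    rcases eq_or_ne f 0 with rfl | hf0
    · simp
    · have hpos := norm_pos_iff.2 hf0
      rw [mul_assoc]
      refine hbound f (η * ‖f‖) (by positivity) fun x hx => ?_
      obtain ⟨y, hy, hxy⟩ := Set.mem_iUnion₂.1 (hcover hx)
      have h := f.lipschitz_bound x y
      rw [hN f hf y hy, sub_zero] at h
      refine h.trans ?_
      rw [mul_comm]
      gcongr
      exact (mem_ball_iff_norm.1 (show (x : X) ∈ ball (y : X) η from hxy)).le
  -- Hahn–Banach: `m` has norm at most `C * η` and agrees with `u` on `N`. Hence `u - m` kills the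
  -- common kernel of finitely many evaluations, and is a combination of them.
  obtain ⟨m, hm, hmn⟩ := exists_extension_norm_eq N (u.comp N.subtypeL)
  refine ⟨u - m, ?_, ?_⟩
  · have hker : ⨅ x : F, LinearMap.ker (delta (x : UnitBall X) : HL0 X ℂ →ₗ[ℂ] ℂ) ≤
        LinearMap.ker ((u - m : StrongDual ℂ (HL0 X ℂ)) : HL0 X ℂ →ₗ[ℂ] ℂ) := by
      intro f hf
      have := hm ⟨f, hf⟩
      simpa [sub_eq_zero] using this.symm
    obtain ⟨c, hc⟩ := (Submodule.mem_span_range_iff_exists_fun ℂ).1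
      (mem_span_of_iInf_ker_le_ker hker)
    have : u - m = ∑ x : F, c x • delta (x : UnitBall X) := by
      ext f
      simpa using (LinearMap.congr_fun hc f).symm
    rw [this]
    exact Submodule.sum_mem _ fun x _ => Submodule.smul_mem _ _ (Submodule.subset_span ⟨x, rfl⟩)
  · rw [dist_eq_norm, sub_sub_cancel, hmn]
    refine lt_of_le_of_lt (ContinuousLinearMap.opNorm_le_bound _ (by positivity) fun f => ?_) hηε
    exact hsmall f f.2

end G0

/-- A bounded operator whose adjoint maps evaluations into `𝓖₀(B_X)` is itself an adjoint. -/
theorem exists_isAdjointOf_of_continuous (A : HL0 X ℂ →L[ℂ] HL0 Y ℂ)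
    (hA : ∀ y, (HL0.delta y).comp A ∈ G0 X) : ∃ T : G0 Y →L[ℂ] G0 X, IsAdjointOf A T := by
  let B : StrongDual ℂ (HL0 Y ℂ) →L[ℂ] StrongDual ℂ (HL0 X ℂ) :=
    (ContinuousLinearMap.compL ℂ (HL0 X ℂ) (HL0 Y ℂ) ℂ).flip A
  have hle : G0 Y ≤ (G0 X).comap (B : StrongDual ℂ (HL0 Y ℂ) →ₗ[ℂ] StrongDual ℂ (HL0 X ℂ)) := by
    refine Submodule.topologicalClosure_minimal _ (Submodule.span_le.2 ?_) ?_
    · rintro _ ⟨y, rfl⟩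
      exact hA y
    · exact (Submodule.isClosed_topologicalClosure _).preimage B.continuous
  exact ⟨(B.comp (G0 Y).subtypeL).codRestrict (G0 X) fun μ => hle μ.2, fun f μ => rfl⟩

/-- Closed graph theorem: evaluations are continuous and separate the points of `𝓗L₀(B_Y)`. -/
theorem continuous_of_continuous_eval {A : HL0 X ℂ →ₗ[ℂ] HL0 Y ℂ}
    (hA : ∀ y, Continuous fun f => A f y) : Continuous A := by
  refine A.continuous_of_seq_closed_graph fun u f g hu hAu => DFunLike.ext _ _ fun y => ?_
  exact tendsto_nhds_unique (((HL0.delta y).continuous.tendsto g).comp hAu)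
    (((hA y).tendsto f).comp hu)

theorem exists_isAdjointOf_of_eval {A : HL0 X ℂ →ₗ[ℂ] HL0 Y ℂ}
    (hA : ∀ y, Continuous[HL0.tau0 X, inferInstance] fun f => A f y) :
    ∃ T : G0 Y →L[ℂ] G0 X, IsAdjointOf A T := by
  choose u hu hAu using fun y => G0.exists_mem_of_continuous_tau0
    ((HL0.delta y : HL0 Y ℂ →ₗ[ℂ] ℂ) ∘ₗ A) (hA y)
  have hcont : Continuous A := continuous_of_continuous_eval fun y => by
    refine (u y).continuous.congr fun f => ?_
    simpa using hAu y f
  refine exists_isAdjointOf_of_continuous ⟨A, hcont⟩ fun y => ?_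
  convert hu y using 1
  ext f
  simpa using (hAu y f).symm

theorem exists_isAdjointOf_of_continuous_tau {A : HL0 X ℂ →ₗ[ℂ] HL0 Y ℂ}
    (hA : Continuous[HL0.tau0 X, HL0.tau0 Y] A ∨ Continuous[HL0.tauP X, HL0.tauP Y] A) :
    ∃ T : G0 Y →L[ℂ] G0 X, IsAdjointOf A T := by
  refine exists_isAdjointOf_of_eval fun y => ?_
  rcases hA with hA | hA
  · exact @Continuous.comp _ _ _ (HL0.tau0 X) (HL0.tau0 Y) _ _ _ (HL0.continuous_eval_tau0 y) hA
  · exact continuous_le_dom HL0.tau0_le_tauP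
      (@Continuous.comp _ _ _ (HL0.tauP X) (HL0.tauP Y) _ _ _ (HL0.continuous_eval_tauP y) hA)

namespace IsCompositionOperator

theorem continuous_tauP {A : HL0 X ℂ → HL0 Y ℂ} (hA : IsCompositionOperator A) :
    Continuous[HL0.tauP X, HL0.tauP Y] A := by
  obtain ⟨φ, hφ, h⟩ := hA
  let _ := HL0.tauP X
  refine continuous_induced_rng.2 (continuous_pi fun y => ?_)
  simpa only [Function.comp_def, h] using HL0.continuous_eval_tauP (⟨φ y, hφ y⟩ : UnitBall X)

theorem continuous_tau0 {A : HL0 X ℂ → HL0 Y ℂ} (hA : IsCompositionOperator A) :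
    Continuous[HL0.tau0 X, HL0.tau0 Y] A := by
  obtain ⟨φ, hφ, h⟩ := hA
  let _ := HL0.tau0 X
  refine continuous_induced_rng.2 ?_
  have hφc : Continuous fun y => (⟨φ y, hφ y⟩ : UnitBall X) := φ.continuous_coe.subtype_mk _
  have := (UniformOnFun.precomp_uniformContinuous (β := ℂ)
    (𝔖 := {K : Set (UnitBall X) | IsCompact K}) (𝔗 := {K : Set (UnitBall Y) | IsCompact K})
    (f := fun y => (⟨φ y, hφ y⟩ : UnitBall X)) fun K hK => IsCompact.image hK hφc).continuous
  refine (this.comp continuous_induced_dom).congr fun f => ?_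
  exact congrArg (UniformOnFun.ofFun _) (funext fun y => (h f y).symm)

theorem exists_isAdjointOf {A : HL0 X ℂ →ₗ[ℂ] HL0 Y ℂ} (hA : IsCompositionOperator A) :
    ∃ T : G0 Y →L[ℂ] G0 X, IsAdjointOf A T :=
  exists_isAdjointOf_of_continuous_tau (.inl hA.continuous_tau0)

end IsCompositionOperator

end

/-! ### Functions reproduced by a multiplicative functional: Cauchy kernels and Cauchy integrals. -/

section

variable {X : Type*} [NormedAddCommGroup X] [NormedSpace ℂ X]
variable {Y : Type*} [NormedAddCommGroup Y] [NormedSpace ℂ Y]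
variable {E : Type*} [NormedAddCommGroup E] [NormedSpace ℂ E]

namespace HL0

theorem mapsTo_unitBall_of_norm_le_one {S : Y →L[ℂ] X} (hS : ‖S‖ ≤ 1) {y : Y}
    (hy : y ∈ UnitBall Y) : S y ∈ UnitBall X := by
  rw [mem_ball_zero_iff] at hy ⊢
  exact (S.le_of_opNorm_le hS y).trans_lt (by simpa using hy)

/-- The composition `f ∘ S` of `f ∈ 𝓗L₀(B_X, E)` with a linear contraction `S`. -/
noncomputable def compCLM (f : HL0 X E) (S : Y →L[ℂ] X) (hS : ‖S‖ ≤ 1) : HL0 Y E :=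
  ofBall (fun y => f.extend (S y))
    (f.differentiableOn_extend.comp S.differentiable.differentiableOn
      fun _ hy => mapsTo_unitBall_of_norm_le_one hS hy) ‖f‖ fun x hx y hy => by
    refine (f.norm_extend_sub_le (mapsTo_unitBall_of_norm_le_one hS hx)
      (mapsTo_unitBall_of_norm_le_one hS hy)).trans ?_
    rw [← map_sub]
    gcongr
    simpa using S.le_of_opNorm_le hS (x - y)

@[simp] theorem compCLM_apply (f : HL0 X E) (S : Y →L[ℂ] X) (hS : ‖S‖ ≤ 1) (y : UnitBall Y) :
    f.compCLM S hS y = f.extend (S y) := by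
  simp [compCLM]

theorem norm_compCLM_le (f : HL0 X E) (S : Y →L[ℂ] X) (hS : ‖S‖ ≤ 1) : ‖f.compCLM S hS‖ ≤ ‖f‖ :=
  norm_ofBall_le _ _ (norm_nonneg _) _

/-- Restriction of bounded linear functionals to the unit ball. -/
noncomputable def ofDual : StrongDual ℂ X →L[ℂ] HL0 X ℂ :=
  LinearMap.mkContinuous
    { toFun := fun s => ofBall s s.differentiable.differentiableOn ‖s‖ fun x _ y _ => by
        rw [← map_sub]
        exact s.le_opNorm _
      map_add' := fun s t => DFunLike.ext _ _ fun x => by simp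
      map_smul' := fun c s => DFunLike.ext _ _ fun x => by simp } 1 fun s => by
    rw [one_mul]
    exact norm_ofBall_le s s.differentiable.differentiableOn (norm_nonneg s) fun x _ y _ => by
      rw [← map_sub]
      exact s.le_opNorm _

@[simp] theorem ofDual_apply (s : StrongDual ℂ X) (x : UnitBall X) : ofDual s x = s x := by
  simp [ofDual]

theorem continuousOn_extend (f : HL0 X E) : ContinuousOn f.extend (UnitBall X) :=
  f.differentiableOn_extend.continuousOn

end HL0

open HL0

/-- The functional `u`, extended to the constants by `u 1 = 1`, takes the value `F x` at the
holomorphic Lipschitz function `F`. -/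
def ReproducesAt (u : StrongDual ℂ (HL0 X ℂ)) (x : X) (F : X → ℂ) : Prop :=
  ∃ h : HL0 X ℂ, (∀ z : UnitBall X, h z = F z - F 0) ∧ u h = F x - F 0

namespace ReproducesAt

variable {u : StrongDual ℂ (HL0 X ℂ)} {x : X} {F G : X → ℂ}

theorem apply_eq (hF : ReproducesAt u x F) {h : HL0 X ℂ} (hh : ∀ z : UnitBall X, h z = F z - F 0) :
    u h = F x - F 0 := by
  obtain ⟨k, hk, hkx⟩ := hF
  rw [← hkx, DFunLike.ext h k fun z => (hh z).trans (hk z).symm]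

theorem congr (hF : ReproducesAt u x F) (hx : x ∈ UnitBall X) (h : Set.EqOn F G (UnitBall X)) :
    ReproducesAt u x G := by
  obtain ⟨k, hk, hkx⟩ := hF
  have h0 := h (UnitBall.origin X).2
  simp only [UnitBall.origin] at h0
  exact ⟨k, fun z => by rw [hk, h z.2, h0], by rw [hkx, h hx, h0]⟩

theorem const (c : ℂ) : ReproducesAt u x fun _ => c := ⟨0, by simp, by simp⟩

theorem mul (hu : ∀ f g : HL0 X ℂ, u (f * g) = u f * u g) (hF : ReproducesAt u x F)
    (hG : ReproducesAt u x G) : ReproducesAt u x fun z => F z * G z := by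
  obtain ⟨h, hh, hhx⟩ := hF
  obtain ⟨k, hk, hkx⟩ := hG
  -- There is no unit in `𝓗L₀`, so `(h + F 0) * (k + G 0) - F 0 * G 0` is expanded.
  refine ⟨h * k + G 0 • h + F 0 • k, fun z => ?_, ?_⟩
  · simp only [HL0.add_apply, HL0.mul_apply, HL0.smul_apply, hh, hk, smul_eq_mul]
    ring
  · simp only [map_add, map_smul, hu, hhx, hkx, smul_eq_mul]
    ring

theorem inv (hu : ∀ f g : HL0 X ℂ, u (f * g) = u f * u g) (hF : ReproducesAt u x F)
    (hF0 : ∀ z ∈ UnitBall X, F z ≠ 0) (hx : x ∈ UnitBall X) {k : HL0 X ℂ}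
    (hk : ∀ z : UnitBall X, k z = (F z)⁻¹ - (F 0)⁻¹) : ReproducesAt u x fun z => (F z)⁻¹ := by
  obtain ⟨h, hh, hhx⟩ := hF
  refine ⟨k, hk, ?_⟩
  have h0 : F 0 ≠ 0 := hF0 0 (UnitBall.origin X).2
  have hx0 := hF0 x hx
  -- The identity `(h + F 0) * (k + (F 0)⁻¹) = 1` without its constants; applying `u` turns it into
  -- a linear equation for `u k` with coefficient `F x ≠ 0`.
  have key : h * k + (F 0)⁻¹ • h + F 0 • k = 0 := DFunLike.ext _ _ fun z => by
    have := hF0 z z.2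
    simp only [HL0.add_apply, HL0.mul_apply, HL0.smul_apply, HL0.zero_apply, hh, hk, smul_eq_mul]
    field_simp
    ring
  have := congrArg u key
  simp only [map_add, map_smul, hu, hhx, smul_eq_mul, map_zero] at this
  have h2 : F x * u k = F x * ((F x)⁻¹ - (F 0)⁻¹) := by
    rw [mul_sub, mul_inv_cancel₀ hx0]
    have : F x * u k = - ((F 0)⁻¹ * (F x - F 0)) := by linear_combination this
    rw [this, mul_sub, inv_mul_cancel₀ h0]
    ring
  exact mul_left_cancel₀ hx0 h2

theorem circleIntegral (hu : u ∈ G0 X) {F : ℂ → X → ℂ} {G : X → ℂ} {C R : ℝ} (hC : 0 ≤ C)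
    (hR : 0 ≤ R) (hx : x ∈ UnitBall X) (hF : ∀ ζ ∈ sphere (0 : ℂ) R, ReproducesAt u x (F ζ))
    (hlip : ∀ ζ ∈ sphere (0 : ℂ) R, ∀ z ∈ UnitBall X, ∀ w ∈ UnitBall X,
      ‖F ζ z - F ζ w‖ ≤ C * ‖z - w‖)
    (hcont : ∀ z ∈ UnitBall X, ContinuousOn (fun ζ => F ζ z) (sphere 0 R))
    (hG : ∀ z ∈ UnitBall X, G z = ∮ ζ in C(0, R), F ζ z) {g : HL0 X ℂ}
    (hg : ∀ z : UnitBall X, g z = G z - G 0) : ReproducesAt u x G := by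
  choose! H hH hHx using hF
  have h0 : (0 : X) ∈ UnitBall X := (UnitBall.origin X).2
  have hcont' : ∀ z ∈ UnitBall X, ContinuousOn (fun ζ => F ζ z - F ζ 0) (sphere 0 R) :=
    fun z hz => (hcont z hz).sub (hcont 0 h0)
  have hint : ∀ z ∈ UnitBall X, G z - G 0 = ∮ ζ in C(0, R), (F ζ z - F ζ 0) := fun z hz => by
    rw [hG z hz, hG 0 h0, ← circleIntegral.integral_sub ((hcont z hz).circleIntegrable hR)
      ((hcont 0 h0).circleIntegrable hR)]
  refine ⟨g, hg, ?_⟩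
  rw [G0.apply_eq_circleIntegral hu (H := H) (C := C) hR, hint x hx]
  · exact circleIntegral.integral_congr hR hHx
  · intro ζ hζ
    refine norm_le_of_lipschitz _ hC fun z w => ?_
    rw [hH ζ hζ, hH ζ hζ, sub_sub_sub_cancel_right]
    exact hlip ζ hζ z z.2 w w.2
  · exact fun z => (hcont' z z.2).congr fun ζ hζ => hH ζ hζ z
  · intro z
    rw [hg, hint z z.2]
    exact circleIntegral.integral_congr hR fun ζ hζ => (hH ζ hζ z).symm

theorem norm_dual_apply_lt_one {s : StrongDual ℂ X} (hs : ‖s‖ ≤ 1) {z : X} (hz : z ∈ UnitBall X) :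
    ‖s z‖ < 1 :=
  (s.le_of_opNorm_le hs z).trans_lt (by simpa using hz)

/-- Radius 2 keeps `ζ` at distance at least 1 from the values of `s` on the ball, so the Cauchy
kernel is bounded by 1 and 1-Lipschitz in `z`. -/
theorem norm_inv_sub_le {s : StrongDual ℂ X} (hs : ‖s‖ ≤ 1) {ζ : ℂ} (hζ : ‖ζ‖ = 2) {z : X}
    (hz : z ∈ UnitBall X) : ζ - s z ≠ 0 ∧ ‖(ζ - s z)⁻¹‖ ≤ 1 := by
  have h1 : 1 ≤ ‖ζ - s z‖ := by
    have := norm_sub_norm_le ζ (s z)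
    have := (norm_dual_apply_lt_one hs hz).le
    linarith
  exact ⟨norm_pos_iff.1 (by linarith), by rw [norm_inv]; exact inv_le_one_of_one_le₀ h1⟩

theorem norm_inv_sub_inv_le {s : StrongDual ℂ X} (hs : ‖s‖ ≤ 1) {ζ : ℂ} (hζ : ‖ζ‖ = 2) {z w : X}
    (hz : z ∈ UnitBall X) (hw : w ∈ UnitBall X) :
    ‖(ζ - s z)⁻¹ - (ζ - s w)⁻¹‖ ≤ 1 * ‖z - w‖ := by
  obtain ⟨hz0, hz1⟩ := norm_inv_sub_le hs hζ hz
  obtain ⟨hw0, hw1⟩ := norm_inv_sub_le hs hζ hw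
  have : (ζ - s z)⁻¹ - (ζ - s w)⁻¹ = (ζ - s z)⁻¹ * s (z - w) * (ζ - s w)⁻¹ := by
    rw [map_sub]
    field_simp
    ring
  rw [this, norm_mul, norm_mul]
  calc _ ≤ 1 * (1 * ‖z - w‖) * 1 := by gcongr; exact s.le_of_opNorm_le hs _
    _ = 1 * ‖z - w‖ := by ring

theorem inv_sub (hu : ∀ f g : HL0 X ℂ, u (f * g) = u f * u g) (hx : x ∈ UnitBall X)
    {s : StrongDual ℂ X} (hs : ‖s‖ ≤ 1) (hux : u (ofDual s) = s x) {ζ : ℂ} (hζ : ‖ζ‖ = 2) :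
    ReproducesAt u x fun z => (ζ - s z)⁻¹ := by
  refine inv hu (F := fun z => ζ - s z) ⟨-ofDual s, fun z => ?_, by simp [hux]⟩
    (fun z hz => (norm_inv_sub_le hs hζ hz).1) hx
    (k := ofBall (fun z => (ζ - s z)⁻¹) ?_ 1 fun z hz w hw => norm_inv_sub_inv_le hs hζ hz hw)
    fun z => rfl
  · have : (-ofDual s) z = -(ofDual s z) := rfl
    simp [this]
  · exact ((differentiableOn_const ζ).sub s.differentiable.differentiableOn).inv
      fun z hz => (norm_inv_sub_le hs hζ hz).1

theorem norm_sum_smul_le {ι : Type*} (I : Finset ι) (s : ι → StrongDual ℂ X) (e : ι → E)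
    (hs : ∀ i, ‖s i‖ ≤ 1) (z : X) : ‖∑ i ∈ I, s i z • e i‖ ≤ (∑ i ∈ I, ‖e i‖) * ‖z‖ := by
  rw [Finset.sum_mul]
  refine norm_sum_le_of_le _ fun i _ => ?_
  rw [norm_smul, mul_comm]
  gcongr
  simpa using (s i).le_of_opNorm_le (hs i) z

section Affine

variable {ι : Type*} {s : ι → StrongDual ℂ X} (hs : ∀ i, ‖s i‖ ≤ 1) {e : ι → E} (f : HL0 E ℂ)
  {I : Finset ι} {a : E} (ha : ‖a‖ + ∑ i ∈ I, ‖e i‖ < 1)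

include hs ha

theorem add_sum_smul_mem {z : X} (hz : z ∈ UnitBall X) :
    a + ∑ i ∈ I, s i z • e i ∈ UnitBall E := by
  rw [mem_ball_zero_iff]
  have h1 := norm_add_le a (∑ i ∈ I, s i z • e i)
  have h2 := (norm_sum_smul_le I s e hs z).trans (mul_le_of_le_one_right
    (Finset.sum_nonneg fun _ _ => norm_nonneg _) (mem_ball_zero_iff.1 hz).le)
  linarith

theorem norm_extend_add_sum_smul_sub_le {z w : X} (hz : z ∈ UnitBall X) (hw : w ∈ UnitBall X) :
    ‖f.extend (a + ∑ i ∈ I, s i z • e i) - f.extend (a + ∑ i ∈ I, s i w • e i)‖ ≤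
      ‖f‖ * ‖z - w‖ := by
  refine (f.norm_extend_sub_le (add_sum_smul_mem hs ha hz) (add_sum_smul_mem hs ha hw)).trans ?_
  gcongr
  rw [add_sub_add_left_eq_sub, ← Finset.sum_sub_distrib]
  simp only [← sub_smul, ← map_sub]
  refine (norm_sum_smul_le I s e hs (z - w)).trans (mul_le_of_le_one_left (norm_nonneg _) ?_)
  have := norm_nonneg a
  linarith

theorem differentiableOn_extend_add_sum_smul :
    DifferentiableOn ℂ (fun z => f.extend (a + ∑ i ∈ I, s i z • e i)) (UnitBall X) := by
  refine f.differentiableOn_extend.fun_comp (f := fun z => a + ∑ i ∈ I, s i z • e i) ?_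
    fun z hz => add_sum_smul_mem hs ha hz
  fun_prop

end Affine

/-- Cauchy's formula, one variable at a time: `s j z` is replaced by a point `ζ` of the circle of
radius 2, at the price of the kernel `(ζ - s j z)⁻¹`. The kernel is reproduced by `inv_sub`, the
other factor by induction with `a + ζ • e j` in place of `a`. The factor 2 in `ha` leaves room for
`‖ζ‖ = 2`. -/
theorem comp_add_sum_smul (hu0 : u ∈ G0 X) (hu : ∀ f g : HL0 X ℂ, u (f * g) = u f * u g)
    (hx : x ∈ UnitBall X) {ι : Type*} {s : ι → StrongDual ℂ X} (hs : ∀ i, ‖s i‖ ≤ 1)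
    (hux : ∀ i, u (ofDual (s i)) = s i x) (e : ι → E) (f : HL0 E ℂ) (I : Finset ι) (a : E)
    (ha : ‖a‖ + 2 * ∑ i ∈ I, ‖e i‖ < 1) :
    ReproducesAt u x fun z => f.extend (a + ∑ i ∈ I, s i z • e i) := by
  classical
  induction I using Finset.induction_on generalizing a with
  | empty => simpa using const _
  | insert j I hj ih =>
    have ha' : ‖a‖ + ∑ i ∈ insert j I, ‖e i‖ < 1 := by
      have : 0 ≤ ∑ i ∈ insert j I, ‖e i‖ := Finset.sum_nonneg fun _ _ => norm_nonneg _
      linarith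
    rw [Finset.sum_insert hj] at ha
    have hI : 0 ≤ ∑ i ∈ I, ‖e i‖ := Finset.sum_nonneg fun _ _ => norm_nonneg _
    have hζa : ∀ ζ ∈ closedBall (0 : ℂ) 2, ‖a + ζ • e j‖ + 2 * ∑ i ∈ I, ‖e i‖ < 1 := by
      intro ζ hζ
      have h1 : ‖ζ • e j‖ ≤ 2 * ‖e j‖ := by
        rw [norm_smul]
        gcongr
        exact mem_closedBall_zero_iff.1 hζ
      have := norm_add_le a (ζ • e j)
      linarith
    have hζa' : ∀ ζ ∈ closedBall (0 : ℂ) 2, ‖a + ζ • e j‖ + ∑ i ∈ I, ‖e i‖ < 1 := fun ζ hζ => by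
      linarith [hζa ζ hζ]
    have hsph : ∀ ζ ∈ sphere (0 : ℂ) 2, ‖ζ‖ = 2 := fun ζ => mem_sphere_zero_iff_norm.1
    have hdiff : ∀ z ∈ UnitBall X, DifferentiableOn ℂ
        (fun ζ : ℂ => f.extend (a + ζ • e j + ∑ i ∈ I, s i z • e i)) (closedBall 0 2) := fun z hz =>
      f.differentiableOn_extend.fun_comp (f := fun ζ : ℂ => a + ζ • e j + ∑ i ∈ I, s i z • e i)
        (by fun_prop) fun ζ hζ => add_sum_smul_mem hs (hζa' ζ hζ) hz
    let q : ℂ → X → ℂ := fun ζ z =>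
      (ζ - s j z)⁻¹ * f.extend (a + ζ • e j + ∑ i ∈ I, s i z • e i)
    have hCauchy : ∀ z ∈ UnitBall X, (2 * Real.pi * Complex.I : ℂ) *
        f.extend (a + ∑ i ∈ insert j I, s i z • e i) = ∮ ζ in C(0, 2), q ζ z := by
      intro z hz
      rw [Finset.sum_insert hj, ← add_assoc]
      exact ((hdiff z hz).circleIntegral_sub_inv_smul (w := s j z) (mem_ball_zero_iff.2
        ((norm_dual_apply_lt_one (hs j) hz).trans (by norm_num)))).symm
    have hqlip : ∀ ζ ∈ sphere (0 : ℂ) 2, ∀ z ∈ UnitBall X, ∀ w ∈ UnitBall X,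
        ‖q ζ z - q ζ w‖ ≤ (‖f‖ + ‖f‖) * ‖z - w‖ := by
      intro ζ hζ z hz w hw
      have hζ' := sphere_subset_closedBall hζ
      have h1 := norm_extend_add_sum_smul_sub_le hs f (hζa' ζ hζ') hz hw
      have h2 := norm_inv_sub_inv_le (hs j) (hsph ζ hζ) hz hw
      have h3 := (norm_inv_sub_le (hs j) (hsph ζ hζ) hz).2
      have h4 := f.norm_extend_le (add_sum_smul_mem hs (hζa' ζ hζ') hw)
      simp only [q]
      generalize f.extend (a + ζ • e j + ∑ i ∈ I, s i z • e i) = A at *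
      generalize f.extend (a + ζ • e j + ∑ i ∈ I, s i w • e i) = B at *
      generalize (ζ - s j z)⁻¹ = p at *
      generalize (ζ - s j w)⁻¹ = r at *
      calc ‖p * A - r * B‖ = ‖p * (A - B) + (p - r) * B‖ := by ring_nf
        _ ≤ ‖p‖ * ‖A - B‖ + ‖p - r‖ * ‖B‖ := by
          refine (norm_add_le _ _).trans ?_
          rw [norm_mul, norm_mul]
        _ ≤ 1 * (‖f‖ * ‖z - w‖) + (1 * ‖z - w‖) * ‖f‖ := by gcongr
        _ = _ := by ring
    have hrep := circleIntegral (x := x) hu0 (F := q)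
      (G := fun z => (2 * Real.pi * Complex.I : ℂ) * f.extend (a + ∑ i ∈ insert j I, s i z • e i))
      (C := ‖f‖ + ‖f‖) (R := 2) (by positivity) zero_le_two hx
      (fun ζ hζ => (inv_sub hu hx (hs j) (hux j) (hsph ζ hζ)).mul hu
        (ih _ (hζa ζ (sphere_subset_closedBall hζ)))) hqlip
      (fun z hz => ((continuousOn_id.sub continuousOn_const).inv₀
        fun ζ hζ => (norm_inv_sub_le (hs j) (hsph ζ hζ) hz).1).mul
          ((hdiff z hz).continuousOn.mono sphere_subset_closedBall)) hCauchy
      (g := (2 * Real.pi * Complex.I : ℂ) • ofBall _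
        (differentiableOn_extend_add_sum_smul hs f ha') _
          fun z hz w hw => norm_extend_add_sum_smul_sub_le hs f ha' hz hw)
      fun z => by simp [mul_sub]
    refine ((const (2 * Real.pi * Complex.I : ℂ)⁻¹).mul hu hrep).congr hx fun z _ => ?_
    exact inv_mul_cancel_left₀ Complex.two_pi_I_ne_zero _

end ReproducesAt
end

/-! ### From finite rank to the identity: dilations and the BAP. -/

section

variable {X : Type*} [NormedAddCommGroup X] [NormedSpace ℂ X]

open HL0

theorem ContinuousLinearMap.exists_eq_sum_smul_of_finiteDimensional_range {E : Type*} [NormedAddCommGroup E]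
    [NormedSpace ℂ E] (S : X →L[ℂ] E)
    [FiniteDimensional ℂ (LinearMap.range (S : X →ₗ[ℂ] E))] :
    ∃ (n : ℕ) (s : Fin n → StrongDual ℂ X) (e : Fin n → E), (∀ i, ‖s i‖ ≤ 1) ∧
      ∀ z, S z = ∑ i, s i z • e i := by
  let b := Module.finBasis ℂ (LinearMap.range (S : X →ₗ[ℂ] E))
  let S' : X →L[ℂ] LinearMap.range (S : X →ₗ[ℂ] E) := S.codRestrict _ fun z => ⟨z, rfl⟩
  let t : Fin _ → StrongDual ℂ X := fun i => (LinearMap.toContinuousLinearMap (b.coord i)).comp S'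
  have hpos : ∀ i, (0 : ℝ) < ‖t i‖ + 1 := fun i => by positivity
  -- Rescaling makes the coordinate functionals contractive; the added 1 avoids division by zero.
  refine ⟨_, fun i => ((‖t i‖ + 1 : ℝ) : ℂ)⁻¹ • t i, fun i => ((‖t i‖ + 1 : ℝ) : ℂ) • (b i : E),
    fun i => ?_, fun z => ?_⟩
  · rw [norm_smul, norm_inv, Complex.norm_real, Real.norm_of_nonneg (hpos i).le,
      inv_mul_le_iff₀ (hpos i)]
    linarith
  · have h := congrArg Subtype.val (b.sum_repr (S' z))
    rw [Submodule.coe_sum] at h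
    refine h.symm.trans (Finset.sum_congr rfl fun i _ => ?_)
    have : ((‖t i‖ + 1 : ℝ) : ℂ) ≠ 0 := Complex.ofReal_ne_zero.2 (hpos i).ne'
    rw [_root_.smul_apply, smul_eq_mul, smul_smul, mul_right_comm, inv_mul_cancel₀ this, one_mul]
    rfl

theorem norm_smul_id_le (r : ℂ) : ‖r • ContinuousLinearMap.id ℂ X‖ ≤ ‖r‖ := by
  rw [norm_smul]
  exact mul_le_of_le_one_right (norm_nonneg _) ContinuousLinearMap.norm_id_le

theorem smul_mem_unitBall {r : ℂ} (hr : ‖r‖ ≤ 1) {z : X} (hz : z ∈ UnitBall X) :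
    r • z ∈ UnitBall X := by
  simpa using mapsTo_unitBall_of_norm_le_one ((norm_smul_id_le (X := X) r).trans hr) hz

namespace G0

variable {u : StrongDual ℂ (HL0 X ℂ)} {x : X}

/-- By the identity theorem in `r`, it suffices to evaluate `u` on the dilations `z ↦ f (r z)` for
small `r`. -/
theorem apply_eq_of_dilations (hu : u ∈ G0 X) (hx : x ∈ UnitBall X) (f : HL0 X ℂ) {r₀ : ℝ}
    (hr₀ : 0 < r₀)
    (h : ∀ r : ℂ, ‖r‖ < r₀ → ‖r‖ ≤ 1 → ReproducesAt u x fun z => f.extend (r • z)) :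
    u f = f.extend x := by
  have hex : ∀ r ∈ closedBall (0 : ℂ) 1, ∃ g : HL0 X ℂ, ‖g‖ ≤ ‖f‖ ∧
      ∀ z : UnitBall X, g z = f.extend (r • (z : X)) := fun r hr =>
    ⟨f.compCLM (r • ContinuousLinearMap.id ℂ X)
      ((norm_smul_id_le r).trans (mem_closedBall_zero_iff.1 hr)), norm_compCLM_le _ _ _, by simp⟩
  choose! H hHn hH using hex
  have hmaps : ∀ z ∈ UnitBall X, Set.MapsTo (fun r : ℂ => r • z) (closedBall 0 1) (UnitBall X) :=
    fun z hz r hr => smul_mem_unitBall (mem_closedBall_zero_iff.1 hr) hz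
  have hd : ∀ z ∈ UnitBall X, DifferentiableOn ℂ (fun r : ℂ => f.extend (r • z)) (closedBall 0 1) :=
    fun z hz => f.differentiableOn_extend.fun_comp (f := fun r : ℂ => r • z)
      (by fun_prop) (hmaps z hz)
  have hc : ContinuousOn (fun r => u (H r)) (closedBall 0 1) :=
    continuousOn_apply hu hHn fun z => (hd z z.2).continuousOn.congr fun r hr => hH r hr z
  have hd' : DifferentiableOn ℂ (fun r => u (H r)) (ball 0 1) :=
    differentiableOn_apply hu isOpen_ball (fun r hr => hHn r (ball_subset_closedBall hr))
      fun z => ((hd z z.2).mono ball_subset_closedBall).congr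
        fun r hr => hH r (ball_subset_closedBall hr) z
  have hnear : (fun r => u (H r)) =ᶠ[𝓝 0] fun r => f.extend (r • x) := by
    filter_upwards [ball_mem_nhds (0 : ℂ) hr₀, ball_mem_nhds (0 : ℂ) one_pos] with r hr hr1
    rw [mem_ball_zero_iff] at hr
    have := (h r hr (mem_ball_zero_iff.1 hr1).le).apply_eq (h := H r) fun z => by
      simp [hH r (ball_subset_closedBall hr1)]
    simpa using this
  have heq : Set.EqOn (fun r => u (H r)) (fun r => f.extend (r • x)) (ball 0 1) :=
    (hd'.analyticOnNhd isOpen_ball).eqOn_of_preconnected_of_eventuallyEq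
      (((hd x hx).mono ball_subset_closedBall).analyticOnNhd isOpen_ball)
      (convex_ball _ _).isPreconnected (mem_ball_self one_pos) hnear
  -- The parameter `r = 1` lies on the boundary of the disc, so it is reached by continuity and not
  -- by the identity theorem.
  have h1 : (1 : ℂ) ∈ closedBall (0 : ℂ) 1 := by simp
  have := heq.of_subset_closure hc (hd x hx).continuousOn ball_subset_closedBall
    (closure_ball (0 : ℂ) one_ne_zero).ge h1
  simp only [one_smul] at this
  rw [← this]
  congr 1
  refine DFunLike.ext _ _ fun z => ?_
  simp [hH 1 h1]

theorem apply_compCLM_of_finiteRank (hu0 : u ∈ G0 X)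
    (hu : ∀ f g : HL0 X ℂ, u (f * g) = u f * u g) (hx : x ∈ UnitBall X)
    (hux : ∀ s, u (ofDual s) = s x) (f : HL0 X ℂ) (S : X →L[ℂ] X)
    [FiniteDimensional ℂ (LinearMap.range (S : X →ₗ[ℂ] X))] (hS : ‖S‖ ≤ 1) :
    u (f.compCLM S hS) = f.extend (S x) := by
  obtain ⟨n, s, e, hs, hSe⟩ := S.exists_eq_sum_smul_of_finiteDimensional_range
  have hpos : 0 < 2 * ∑ i, ‖e i‖ + 1 := by
    have : 0 ≤ ∑ i, ‖e i‖ := Finset.sum_nonneg fun _ _ => norm_nonneg _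
    positivity
  -- For `‖r‖` below this radius the vectors `r • e i` meet the smallness condition of
  -- `comp_add_sum_smul`.
  rw [apply_eq_of_dilations hu0 hx (f.compCLM S hS) (inv_pos.2 hpos) fun r hr hr1 => ?_]
  · rw [extend_of_mem _ hx, compCLM_apply]
  · have hsmall : ‖(0 : X)‖ + 2 * ∑ i, ‖r • e i‖ < 1 := by
      simp only [norm_smul, ← Finset.mul_sum, norm_zero, zero_add]
      rw [← one_div, lt_div_iff₀ hpos] at hr
      linarith [norm_nonneg r]
    refine (ReproducesAt.comp_add_sum_smul hu0 hu hx hs (fun i => hux _) (fun i => r • e i) f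
      Finset.univ 0 hsmall).congr hx fun z hz => ?_
    simp only
    rw [extend_of_mem _ (smul_mem_unitBall hr1 hz), compCLM_apply, map_smul, hSe,
      Finset.smul_sum, zero_add]
    congr 1
    exact Finset.sum_congr rfl fun i _ => smul_comm _ _ _

/-- The approximating operators have norm up to `lam` and may leave the ball; dilations with `‖r‖ <
lam⁻¹` make them contractions, and `apply_eq_of_dilations` recovers `r = 1`. -/
theorem apply_eq_of_hasBAP (hX : HasBAP X) (hu0 : u ∈ G0 X)
    (hu : ∀ f g : HL0 X ℂ, u (f * g) = u f * u g) (hx : x ∈ UnitBall X)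
    (hux : ∀ s, u (ofDual s) = s x) (f : HL0 X ℂ) : u f = f.extend x := by
  classical
  obtain ⟨lam, hlam, hX⟩ := hX
  -- Finite sets suffice: functionals in `𝓖₀(B_X)` respect bounded pointwise limits along any
  -- filter, so a net replaces a sequence and `X` need not be separable.
  have hex : ∀ p : Finset X × ℕ, ∃ S : X →L[ℂ] X,
      FiniteDimensional ℂ (LinearMap.range (S : X →ₗ[ℂ] X)) ∧ ‖S‖ ≤ lam ∧
        ∀ z ∈ p.1, ‖S z - z‖ < 1 / ((p.2 : ℝ) + 1) := fun p => by
    simpa using hX p.1 p.1.finite_toSet.isCompact (1 / ((p.2 : ℝ) + 1)) (by positivity)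
  choose S hSfin hSn hSz using hex
  have hSlim : ∀ z, Tendsto (fun p => S p z) atTop (𝓝 z) := fun z => by
    rw [tendsto_iff_norm_sub_tendsto_zero]
    refine squeeze_zero' (.of_forall fun _ => norm_nonneg _) ?_
      (tendsto_one_div_add_atTop_nhds_zero_nat.comp
        ((tendsto_snd.mono_left prod_atTop_atTop_eq.ge : Tendsto (Prod.snd : Finset X × ℕ → ℕ) atTop atTop)))
    filter_upwards [eventually_ge_atTop (({z}, 0) : Finset X × ℕ)] with p hp
    exact (hSz p z (hp.1 (Finset.mem_singleton_self z))).le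
  refine apply_eq_of_dilations hu0 hx f (inv_pos.2 hlam) fun r hr hr1 => ?_
  have hn : ∀ p, ‖r • S p‖ ≤ 1 := fun p => by
    rw [norm_smul]
    calc ‖r‖ * ‖S p‖ ≤ lam⁻¹ * lam := by gcongr; exact hSn p
      _ = 1 := inv_mul_cancel₀ hlam.ne'
  have hlim : ∀ z ∈ UnitBall X,
      Tendsto (fun p => f.extend ((r • S p) z)) atTop (𝓝 (f.extend (r • z))) := fun z hz =>
    (f.continuousOn_extend.continuousAt
      (isOpen_ball.mem_nhds (smul_mem_unitBall hr1 hz))).tendsto.comp ((hSlim z).const_smul r)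
  have hfin : ∀ p, FiniteDimensional ℂ (LinearMap.range ((r • S p : X →L[ℂ] X) : X →ₗ[ℂ] X)) :=
    fun p => by
      have := hSfin p
      refine Submodule.finiteDimensional_of_le (S₂ := LinearMap.range (S p : X →ₗ[ℂ] X)) ?_
      rintro _ ⟨z, rfl⟩
      exact ⟨r • z, by simp⟩
  have hr1' := (norm_smul_id_le (X := X) r).trans hr1
  have hu1 := tendsto_apply hu0 (l := atTop) (H := fun p => f.compCLM (r • S p) (hn p))
    (h := f.compCLM (r • ContinuousLinearMap.id ℂ X) hr1') (C := ‖f‖)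
    (.of_forall fun p => norm_compCLM_le _ _ _) fun z => by simpa using hlim z z.2
  refine ⟨f.compCLM _ hr1', fun z => by simp, ?_⟩
  have hu2 : Tendsto (fun p => u (f.compCLM (r • S p) (hn p))) atTop (𝓝 (f.extend (r • x))) :=
    (hlim x hx).congr fun p =>
      (apply_compCLM_of_finiteRank hu0 hu hx hux f (r • S p) (hn p)).symm
  simpa using tendsto_nhds_unique hu1 hu2

end G0

end

/-! ### Construction of the symbol `φ` and the implication (2) ⇒ (1). -/

section

set_option maxSynthPendingDepth 3

variable {X : Type*} [NormedAddCommGroup X] [NormedSpace ℂ X]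
variable {Y : Type*} [NormedAddCommGroup Y] [NormedSpace ℂ Y]

open HL0

/-- The derivative takes values in the range of `i`, which is closed and contains the difference
quotients, so it can be pulled back. This brings holomorphy of `φ` down from the bidual to `X`. -/
theorem LinearIsometry.differentiableAt_of_comp {V W : Type*} [NormedAddCommGroup V]
    [NormedSpace ℂ V] [CompleteSpace V] [NormedAddCommGroup W] [NormedSpace ℂ W] (i : V →ₗᵢ[ℂ] W)
    {F : Y → V} {y : Y} (h : DifferentiableAt ℂ (fun z => i (F z)) y) :
    DifferentiableAt ℂ F y := by
  obtain ⟨D, hD⟩ := h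
  have hclosed : IsClosed (LinearMap.range i.toLinearMap : Set W) := by
    rw [LinearMap.coe_range]
    exact i.isometry.isClosedEmbedding.isClosed_range
  have hmem : ∀ v, D v ∈ LinearMap.range i.toLinearMap := fun v => by
    refine hclosed.mem_of_tendsto (hD.hasLineDerivAt v).tendsto_slope_zero
      (.of_forall fun t => ⟨t⁻¹ • (F (y + t • v) - F y), by simp⟩)
  let D' : Y →L[ℂ] V := (i.equivRange.symm : _ →L[ℂ] V).comp (D.codRestrict _ hmem)
  have hD' : ∀ v, i (D' v) = D v := fun v =>
    congrArg Subtype.val (i.equivRange.apply_symm_apply ⟨D v, hmem v⟩)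
  refine ⟨D', ?_⟩
  rw [hasFDerivAt_iff_isLittleO] at hD ⊢
  refine Asymptotics.IsLittleO.of_norm_left (hD.norm_left.congr_left fun z => ?_)
  rw [← i.norm_map (F z - F y - D' (z - y)), map_sub i, map_sub i, hD']

namespace HL0

/-- The derivative of `x ↦ δ(x)`: the functionals `f ↦ f'(x) v`. -/
noncomputable def deltaDeriv (x : UnitBall X) : X →L[ℂ] StrongDual ℂ (HL0 X ℂ) :=
  LinearMap.mkContinuous₂
    (LinearMap.mk₂ ℂ (fun (v : X) (f : HL0 X ℂ) => fderiv ℂ f.extend x v)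
      (fun v w f => map_add _ v w) (fun c v f => map_smul _ c v)
      (fun v f g => by
        have h : (f + g).extend =ᶠ[𝓝 (x : X)] f.extend + g.extend := by
          filter_upwards [isOpen_ball.mem_nhds x.2] with y hy
          simp [extend_of_mem _ hy]
        rw [h.fderiv_eq, ((f.hasFDerivAt_extend x.2).add (g.hasFDerivAt_extend x.2)).fderiv]
        rfl)
      (fun c v f => by
        have h : (c • f).extend =ᶠ[𝓝 (x : X)] c • f.extend := by
          filter_upwards [isOpen_ball.mem_nhds x.2] with y hy
          simp [extend_of_mem _ hy]
        rw [h.fderiv_eq, ((f.hasFDerivAt_extend x.2).const_smul c).fderiv]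
        rfl)) 1 fun v f => by
    rw [one_mul, mul_comm]
    exact ContinuousLinearMap.le_of_opNorm_le _ (f.norm_fderiv_extend_le x.2) v

/-- The second order Taylor estimate, uniform in the Lipschitz norm. -/
theorem norm_sub_sub_fderiv_le (f : HL0 X ℂ) {x y : X} {ρ : ℝ}
    (hρ : ball x ρ ⊆ UnitBall X) (hy : y ∈ ball x ρ) :
    ‖f.extend y - f.extend x - fderiv ℂ f.extend x (y - x)‖ ≤ 2 * ‖f‖ / ρ * ‖y - x‖ ^ 2 := by
  have hρ0 : 0 < ρ := pos_of_mem_ball hy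
  have hx : x ∈ UnitBall X := hρ (mem_ball_self hρ0)
  have hfd := f.hasFDerivAt_extend hx
  -- Higher-order Schwarz lemma: the function minus its linear part deviates from its value at `x`
  -- by `o(‖z - x‖)`, and by at most `2 * ‖f‖ * ρ` on the ball, since increment and linear term each
  -- contribute at most `‖f‖ * ρ`.
  have key := Complex.dist_le_mul_div_pow_of_mapsTo_ball_of_isLittleO (n := 1)
    (f := fun z => f.extend z - fderiv ℂ f.extend x (z - x)) (c := x) (R₁ := ρ)
    (R₂ := 2 * ‖f‖ * ρ) (z := y)
    ((f.differentiableOn_extend.mono hρ).sub (by fun_prop)) (fun z hz => ?_) ?_ hy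
  · rw [dist_eq_norm, dist_eq_norm] at key
    simp only [sub_self, map_zero, sub_zero] at key
    rw [sub_right_comm]
    refine key.trans_eq ?_
    rw [div_pow]
    field_simp
  · rw [mem_closedBall, dist_eq_norm]
    simp only [sub_self, map_zero, sub_zero]
    rw [sub_right_comm]
    have h1 := f.norm_extend_sub_le (hρ hz) hx
    have h2 := ContinuousLinearMap.le_of_opNorm_le _ (f.norm_fderiv_extend_le hx) (z - x)
    have h3 : ‖f‖ * ‖z - x‖ ≤ ‖f‖ * ρ := by
      gcongr
      exact (mem_ball_iff_norm.1 hz).le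
    have h4 := norm_sub_le (f.extend z - f.extend x) (fderiv ℂ f.extend x (z - x))
    linarith
  · have := hasFDerivAt_iff_isLittleO.1 hfd
    simp only [pow_one]
    refine this.norm_right.congr_left fun z => ?_
    simp only [sub_self, map_zero, sub_zero]
    ring

/-- The evaluation map `δ` is holomorphic. -/
theorem differentiableAt_of_eq_delta {D : X → StrongDual ℂ (HL0 X ℂ)}
    (hD : ∀ x : UnitBall X, D x = delta x) (x : UnitBall X) : DifferentiableAt ℂ D x := by
  obtain ⟨ρ, hρ0, hρ⟩ := Metric.isOpen_iff.1 (isOpen_ball (x := (0 : X)) (ε := 1)) x x.2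
  refine ⟨deltaDeriv x, hasFDerivAt_iff_isLittleO.2 ?_⟩
  have hO : (fun y => D y - D x - deltaDeriv x (y - x)) =O[𝓝 (x : X)]
      fun y => ‖y - (x : X)‖ ^ 2 := by
    refine Asymptotics.IsBigO.of_bound (2 / ρ) ?_
    filter_upwards [ball_mem_nhds (x : X) hρ0] with y hy
    refine ContinuousLinearMap.opNorm_le_bound _ (by positivity) fun f => ?_
    have h := f.norm_sub_sub_fderiv_le hρ hy
    rw [hD, show D y = delta ⟨y, hρ hy⟩ from hD ⟨y, hρ hy⟩]
    rw [extend_of_mem _ (hρ hy), extend_apply] at h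
    simp only [norm_pow, norm_norm]
    refine h.trans_eq ?_
    ring
  refine hO.trans_isLittleO ?_
  have := (Asymptotics.isLittleO_pow_id (𝕜 := ℝ) one_lt_two).comp_tendsto
    (tendsto_norm_sub_self (x : X))
  exact (this.norm_right.congr_right fun y => norm_norm _).of_norm_right

theorem norm_delta_sub_le (x y : UnitBall X) :
    ‖(delta x - delta y : StrongDual ℂ (HL0 X ℂ))‖ ≤ ‖(x : X) - y‖ :=
  ContinuousLinearMap.opNorm_le_bound _ (norm_nonneg _) fun f =>
    (f.lipschitz_bound x y).trans_eq (mul_comm _ _)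

end HL0

/-- Every element of `𝓖₀(B_X)` acts on `X^*` as the evaluation at a point of `X`. -/
theorem G0.exists_barycenter [CompleteSpace X] {u : StrongDual ℂ (HL0 X ℂ)} (hu : u ∈ G0 X) :
    ∃ x : X, ∀ s, u (ofDual s) = s x := by
  let J := NormedSpace.inclusionInDoubleDualLi (E := X) ℂ
  let B : StrongDual ℂ (HL0 X ℂ) →L[ℂ] StrongDual ℂ (StrongDual ℂ X) :=
    (ContinuousLinearMap.compL ℂ (StrongDual ℂ X) (HL0 X ℂ) ℂ).flip ofDual
  -- Restriction to `X^*` sends evaluations into the canonical copy of `X` in its bidual, which is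
  -- closed because `X` is complete.
  have hle : G0 X ≤ (LinearMap.range J.toLinearMap).comap
      (B : StrongDual ℂ (HL0 X ℂ) →ₗ[ℂ] StrongDual ℂ (StrongDual ℂ X)) := by
    refine Submodule.topologicalClosure_minimal _ (Submodule.span_le.2 ?_) ?_
    · rintro _ ⟨x, rfl⟩
      refine ⟨x, ?_⟩
      ext s
      exact (ofDual_apply s x).symm
    · refine IsClosed.preimage B.continuous (t := LinearMap.range J.toLinearMap) ?_
      rw [LinearMap.coe_range]
      exact J.isometry.isClosedEmbedding.isClosed_range
  obtain ⟨x, hx⟩ := hle hu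
  exact ⟨x, fun s => (DFunLike.congr_fun hx s).symm⟩

/-- Multiplicative functionals are bounded by one on contractive linear functionals. -/
theorem norm_apply_ofDual_le_one {u : HL0 X ℂ →ₗ[ℂ] ℂ}
    (hu : ∀ f g : HL0 X ℂ, u (f * g) = u f * u g) {s : StrongDual ℂ X} (hs : ‖s‖ ≤ 1) :
    ‖u (ofDual s)‖ ≤ 1 := by
  by_contra! hc
  set c := u (ofDual s) with hcdef
  have hd : 0 < ‖c‖ - 1 := by linarith
  have hlow : ∀ z ∈ UnitBall X, ‖c‖ - 1 ≤ ‖c - s z‖ := fun z hz => by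
    have := norm_sub_norm_le c (s z)
    have := (ReproducesAt.norm_dual_apply_lt_one hs hz).le
    linarith
  have hne : ∀ z ∈ UnitBall X, c - s z ≠ 0 := fun z hz =>
    norm_pos_iff.1 (hd.trans_le (hlow z hz))
  -- If `‖c‖ > 1`, then `g = s / (c - s)` belongs to `𝓗L₀` and solves `c g - g s = s`. Applying `u`,
  -- with `u s = c`, gives `0 = c`.
  let g : HL0 X ℂ := ofBall (fun z => s z / (c - s z))
    (by
      simp only [div_eq_mul_inv]
      exact s.differentiable.differentiableOn.mul
        ((s.differentiable.differentiableOn.const_sub c).inv hne)) (‖c‖ / (‖c‖ - 1) ^ 2)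
    fun z hz w hw => by
      have hz0 := hne z hz
      have hw0 := hne w hw
      have : s z / (c - s z) - s w / (c - s w) = c * s (z - w) / ((c - s z) * (c - s w)) := by
        rw [map_sub]
        field_simp
        ring
      rw [this, norm_div, norm_mul, norm_mul, div_mul_eq_mul_div, pow_two]
      gcongr
      · simpa using s.le_of_opNorm_le hs (z - w)
      · exact hlow z hz
      · exact hlow w hw
  have hg : c • g - g * ofDual s = ofDual s := DFunLike.ext _ _ fun z => by
    have := hne z z.2
    simp only [HL0.sub_apply, HL0.smul_apply, HL0.mul_apply, ofDual_apply, g, ofBall_apply,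
      map_zero, zero_div, sub_zero, smul_eq_mul]
    field_simp
  have := congrArg u hg
  rw [map_sub, map_smul, hu, ← hcdef, smul_eq_mul, mul_comm, sub_self] at this
  rw [← this, norm_zero] at hc
  linarith

namespace IsAdjointOf

variable {A : HL0 X ℂ →ₗ[ℂ] HL0 Y ℂ} {T : G0 Y →L[ℂ] G0 X}

theorem apply_delta (hT : IsAdjointOf A T) (f : HL0 X ℂ) (y : UnitBall Y) :
    (T ⟨delta y, G0.delta_mem y⟩ : StrongDual ℂ (HL0 X ℂ)) f = A f y :=
  (hT f ⟨delta y, G0.delta_mem y⟩).symm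

theorem continuous (hT : IsAdjointOf A T) : Continuous A := by
  refine AddMonoidHomClass.continuous_of_bound A ‖T‖ fun f =>
    norm_le_of_lipschitz _ (by positivity) fun y y' => ?_
  rw [← hT.apply_delta, ← hT.apply_delta, ← _root_.sub_apply, ← Submodule.coe_sub, ← map_sub]
  refine (ContinuousLinearMap.le_opNorm _ _).trans ?_
  rw [mul_right_comm]
  gcongr
  refine (T.le_opNorm _).trans ?_
  gcongr
  exact norm_delta_sub_le y y'

theorem isCompositionOperator [CompleteSpace X] (hT : IsAdjointOf A T)
    (hA : ∀ f g : HL0 X ℂ, A (f * g) = A f * A g) (hX : HasBAP X) : IsCompositionOperator A := by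
  have hu : ∀ y : UnitBall Y, ∃ u ∈ G0 X, ∀ f, u f = A f y := fun y =>
    ⟨_, (T ⟨delta y, G0.delta_mem y⟩).2, fun f => hT.apply_delta f y⟩
  choose u hu0 huA using hu
  choose φ hφ using fun y => G0.exists_barycenter (hu0 y)
  have hφA : ∀ y s, A (ofDual s) y = s (φ y) := fun y s => by rw [← hφ, huA]
  have hmul : ∀ y (f g : HL0 X ℂ), u y (f * g) = u y f * u y g := fun y f g => by
    simp only [huA, hA, HL0.mul_apply]
  let J := NormedSpace.inclusionInDoubleDualLi (E := X) ℂ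
  let A' : HL0 X ℂ →L[ℂ] HL0 Y ℂ := ⟨A, hT.continuous⟩
  let B : StrongDual ℂ (HL0 Y ℂ) →L[ℂ] StrongDual ℂ (StrongDual ℂ X) :=
    (ContinuousLinearMap.compL ℂ (StrongDual ℂ X) (HL0 Y ℂ) ℂ).flip (A'.comp ofDual)
  -- In the bidual, `φ` is a bounded linear map applied to `δ`; the Lipschitz estimate and
  -- holomorphy are read off from this.
  have hJ : ∀ y, J (φ y) = B (delta y) := fun y => by
    ext s
    exact (hφA y s).symm
  have hlip : ∀ y y', ‖φ y - φ y'‖ ≤ ‖B‖ * ‖(y : Y) - y'‖ := fun y y' => by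
    rw [← J.norm_map, map_sub, hJ, hJ, ← map_sub]
    refine (B.le_opNorm _).trans ?_
    gcongr
    exact norm_delta_sub_le y y'
  have hhol : IsHolomorphicOnBall φ := by
    refine ⟨Function.extend Subtype.val φ 0, fun y hy => ?_,
      fun y => Subtype.val_injective.extend_apply _ _ _⟩
    lift y to UnitBall Y using hy
    refine (J.differentiableAt_of_comp ?_).differentiableWithinAt
    have := B.differentiableAt.comp (y : Y) (differentiableAt_of_eq_delta
      (D := Function.extend Subtype.val delta 0)
      (fun x => Subtype.val_injective.extend_apply _ _ _) y)
    refine this.congr_of_eventuallyEq ?_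
    filter_upwards [isOpen_ball.mem_nhds y.2] with z hz
    lift z to UnitBall Y using hz
    simp [hJ]
  -- Schwarz lemma for `A (ofDual s)`, with `s` norming `φ y`: this function vanishes at the origin
  -- and is bounded by 1. The bound forces both `φ 0 = 0` and values in the open ball.
  have hball : ∀ y, ‖φ y‖ ≤ ‖(y : Y)‖ := fun y => by
    obtain ⟨s, hs, hsφ⟩ := exists_dual_vector'' ℂ (φ y)
    have h := Complex.norm_le_norm_of_mapsTo_ball (f := (A (ofDual s)).extend) (z := (y : Y))
      (R := 1) (differentiableOn_extend _) (fun z hz => ?_) (extend_zero _)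
      (mem_ball_zero_iff.1 y.2)
    · simpa [hφA, hsφ] using h
    · lift z to UnitBall Y using hz
      rw [mem_closedBall_zero_iff, extend_apply, ← huA]
      exact norm_apply_ofDual_le_one (u := (u z : HL0 X ℂ →ₗ[ℂ] ℂ)) (hmul z) hs
  have hφ0 : φ (UnitBall.origin Y) = 0 := by simpa [UnitBall.origin] using hball (UnitBall.origin Y)
  have hφmem : ∀ y, φ y ∈ UnitBall X := fun y =>
    mem_ball_zero_iff.2 ((hball y).trans_lt (mem_ball_zero_iff.1 y.2))
  refine ⟨⟨φ, hhol, ⟨‖B‖₊, LipschitzWith.of_dist_le_mul fun y y' => ?_⟩, hφ0⟩, hφmem,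
    fun f y => ?_⟩
  · rw [dist_eq_norm, Subtype.dist_eq, dist_eq_norm]
    exact hlip y y'
  · rw [← huA, G0.apply_eq_of_hasBAP hX (hu0 y) (hmul y) (hφmem y) (hφ y), extend_of_mem]
    rfl

end IsAdjointOf

end

end

theorem theorem3p13
    {X : Type*} [NormedAddCommGroup X] [NormedSpace ℂ X] [CompleteSpace X]
    {Y : Type*} [NormedAddCommGroup Y] [NormedSpace ℂ Y] [CompleteSpace Y]
    (A : HL0 X ℂ →ₗ[ℂ] HL0 Y ℂ) (hA : ∀ f g : HL0 X ℂ, A (f * g) = A f * A g) :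
    (IsCompositionOperator A →
      (∃ T : G0 Y →L[ℂ] G0 X, IsAdjointOf A T) ∧
      Continuous[HL0.tau0 X, HL0.tau0 Y] A ∧
      Continuous[HL0.tauP X, HL0.tauP Y] A) ∧
    ((Continuous[HL0.tau0 X, HL0.tau0 Y] A ∨ Continuous[HL0.tauP X, HL0.tauP Y] A) →
      ∃ T : G0 Y →L[ℂ] G0 X, IsAdjointOf A T) ∧
    (HasBAP X →
      List.TFAE
        [IsCompositionOperator A,
          ∃ T : G0 Y →L[ℂ] G0 X, IsAdjointOf A T,
          Continuous[HL0.tau0 X, HL0.tau0 Y] A,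
          Continuous[HL0.tauP X, HL0.tauP Y] A]) := by
  refine ⟨fun h => ⟨h.exists_isAdjointOf, h.continuous_tau0, h.continuous_tauP⟩,
    exists_isAdjointOf_of_continuous_tau, fun hX => ?_⟩
  tfae_have 1 → 3 := fun h => h.continuous_tau0
  tfae_have 1 → 4 := fun h => h.continuous_tauP
  tfae_have 3 → 2 := fun h => exists_isAdjointOf_of_continuous_tau (.inl h)
  tfae_have 4 → 2 := fun h => exists_isAdjointOf_of_continuous_tau (.inr h)
  tfae_have 2 → 1 := fun ⟨_, hT⟩ => hT.isCompositionOperator hA hX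
  tfae_finish
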